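/- Let $\lambda\ge 0$, $1\le p<\infty$, $0<T\le\infty$, $\frac1p+\frac1{p'}=1$ (with $p'=\infty$ if $p=1$), and $\mathbb{R}^+=(0,\infty)$. Let $\Delta_\lambda=-\frac{d^2}{dx^2}-\frac{2\lambda}{x}\frac{d}{dx}$ be the Bessel operator on $\mathbb{R}^+$ and $d\mu_\lambda(y)=y^{2\lambda}\,dy$. For $t,x,y>0$ let $$W_t^\lambda(x,y)=\frac{(xy)^{-\lambda+\frac12}}{2t}\,e^{-\frac{x^2+y^2}{4t}}\,I_{\lambda-\frac12}\!\left(\frac{xy}{2t}\right),\qquad P_t^\lambda(x,y)=\frac{t}{\sqrt{4\pi}}\int_0^\infty e^{-\frac{t^2}{4s}}\,W_s^\lambda(x,y)\,\frac{ds}{s^{3/2}}$$ be the heat and Poisson kernels of $\Delta_\lambda$, where $I_\nu(z)=\sum_{k\ge0}\frac{(z/2)^{2k+\nu}}{k!\,\Gamma(k+\nu+1)}$ is the modified Bessel function of the first kind, and put $$\phi_t^\lambda(y)=y^\lambda\left(\frac{y}{y+1}\right)^\lambda e^{-\frac{y^2}{4t}},\qquad \phi^\lambda(y)=\frac{y^{2\lambda}}{(y^2+1)^{\lambda+1}}.$$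 A weight is a measurable function $v:\mathbb{R}^+\to\mathbb{R}^+$. Let $D_p^{heat}(\Delta_\lambda)$ be the class of all weights $v$ such that for every real-valued $f\in L^p(\mathbb{R}^+,v\,dy)$ the integral $u(t,x)=\int_0^\infty W_t^\lambda(x,y)f(y)\,d\mu_\lambda(y)$ converges absolutely for all $t\in(0,T)$ and $x>0$, $u\in C^\infty((0,T)\times\mathbb{R}^+)$, $u_t=-\Delta_\lambda u$ on $(0,T)\times\mathbb{R}^+$, and $\lim_{t\to0^+}u(t,x)=f(x)$ for a.e. $x>0$. Let $D_p^{Poisson}(\Delta_\lambda)$ be the class defined in the same way with $P_t^\lambda$ in place of $W_t^\lambda$ and the equation $u_{tt}=\Delta_\lambda u$ in place of $u_t=-\Delta_\lambda u$. Then, for every weight $v$: 1. $v\in D_p^{heat}(\Delta_\lambda)$ if and only if $v^{-1/p}\phi_t^\lambda\in L^{p'}(\mathbb{R}^+,dy)$ for every $t\in(0,T)$; 2. $v\in D_p^{Poisson}(\Delta_\lambda)$ if and only if $v^{-1/p}\phi^\lambda\in L^{p'}(\mathbb{R}^+,dy)$. In particular, the second class does not depend on $T$; the case $T=\infty$ is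 the Poisson problem on $(0,\infty)\times\mathbb{R}^+$. -/

import Mathlib

open MeasureTheory Filter Set Topology
open scoped ENNReal ContDiff

noncomputable section

namespace Bessel

/-- The modified Bessel function of the first kind `I_ν(z)`, for `z > 0` and `ν > -1`. -/
def besselI (ν z : ℝ) : ℝ :=
  ∑' k : ℕ, (z / 2) ^ (2 * (k : ℝ) + ν) / ((k.factorial : ℝ) * Real.Gamma ((k : ℝ) + ν + 1))

/-- The Bessel operator `Δ_λ g = -g'' - (2λ/x) g'`. -/
def besselOp (lam : ℝ) (g : ℝ → ℝ) (x : ℝ) : ℝ :=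
  -(deriv (deriv g) x) - 2 * lam / x * deriv g x

/-- The heat kernel `W_t^λ(x, y)` of `Δ_λ`, for `t, x, y > 0`. -/
def heatKernel (lam t x y : ℝ) : ℝ :=
  (x * y) ^ (-lam + 1 / 2) / (2 * t) * Real.exp (-(x ^ 2 + y ^ 2) / (4 * t)) *
    besselI (lam - 1 / 2) (x * y / (2 * t))

/-- The Poisson kernel `P_t^λ(x, y)` of `Δ_λ`, for `t, x, y > 0`, that is, the kernel of
`exp (-t √Δ_λ)`, obtained from the heat kernel by subordination. -/
def poissonKernel (lam t x y : ℝ) : ℝ :=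
  t / √(4 * Real.pi) *
    ∫ s in Ioi (0 : ℝ), Real.exp (-t ^ 2 / (4 * s)) * heatKernel lam s x y / s ^ (3 / 2 : ℝ)

/-- The integral of `f` against a kernel `K_t(x, y)` with respect to `dμ_λ(y) = y^{2λ} dy`
on `(0, ∞)`. -/
def kernelIntegral (lam : ℝ) (K : ℝ → ℝ → ℝ → ℝ) (f : ℝ → ℝ) (t x : ℝ) : ℝ :=
  ∫ y in Ioi (0 : ℝ), K t x y * f y * y ^ (2 * lam)

/-- The time interval `(0, T)`, with `T = ⊤` allowed. -/
def timeInterval (T : EReal) : Set ℝ := {t | 0 < t ∧ (t : EReal) < T}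

/-- The integral of `f` against `K` converges absolutely at every point of `(0, T) × (0, ∞)`. -/
def AbsConv (lam : ℝ) (K : ℝ → ℝ → ℝ → ℝ) (T : EReal) (f : ℝ → ℝ) : Prop :=
  ∀ t ∈ timeInterval T, ∀ x : ℝ, 0 < x →
    IntegrableOn (fun y => K t x y * f y * y ^ (2 * lam)) (Ioi 0)

/-- `u` is `C^∞` on `(0, T) × (0, ∞)`. -/
def SmoothOn (T : EReal) (u : ℝ → ℝ → ℝ) : Prop :=
  ContDiffOn ℝ ∞ (fun q : ℝ × ℝ => u q.1 q.2) (timeInterval T ×ˢ Ioi (0 : ℝ))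

/-- `u` satisfies `u_t = -Δ_λ u` on `(0, T) × (0, ∞)`. -/
def HeatEq (lam : ℝ) (T : EReal) (u : ℝ → ℝ → ℝ) : Prop :=
  ∀ t ∈ timeInterval T, ∀ x : ℝ, 0 < x →
    deriv (fun s => u s x) t = -besselOp lam (u t) x

/-- `u` satisfies `u_tt = Δ_λ u` on `(0, T) × (0, ∞)`. -/
def PoissonEq (lam : ℝ) (T : EReal) (u : ℝ → ℝ → ℝ) : Prop :=
  ∀ t ∈ timeInterval T, ∀ x : ℝ, 0 < x →
    deriv (deriv (fun s => u s x)) t = besselOp lam (u t) x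

/-- `u(t, x) → f(x)` as `t → 0⁺`, for a.e. `x > 0`. -/
def HasInitialData (u : ℝ → ℝ → ℝ) (f : ℝ → ℝ) : Prop :=
  ∀ᵐ x ∂(volume.restrict (Ioi (0 : ℝ))), Tendsto (fun t => u t x) (𝓝[>] 0) (𝓝 (f x))

/-- A weight: a measurable function from `(0, ∞)` to `(0, ∞)`. Only the values on `(0, ∞)`
matter. -/
def IsWeight (v : ℝ → ℝ) : Prop :=
  AEMeasurable v (volume.restrict (Ioi (0 : ℝ))) ∧ ∀ y : ℝ, 0 < y → 0 < v y

/-- The measure `v(y) dy` on `(0, ∞)`. -/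
def weightMeasure (v : ℝ → ℝ) : Measure ℝ :=
  (volume.restrict (Ioi (0 : ℝ))).withDensity (fun y => ENNReal.ofReal (v y))

/-- The class `D_p^heat(Δ_λ)` on the time interval `(0, T)`. -/
def heatClass (lam : ℝ) (T : EReal) (p : ℝ≥0∞) : Set (ℝ → ℝ) :=
  {v | IsWeight v ∧ ∀ f : ℝ → ℝ, MemLp f p (weightMeasure v) →
    AbsConv lam (heatKernel lam) T f ∧
    SmoothOn T (kernelIntegral lam (heatKernel lam) f) ∧
    HeatEq lam T (kernelIntegral lam (heatKernel lam) f) ∧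
    HasInitialData (kernelIntegral lam (heatKernel lam) f) f}

/-- The class `D_p^Poisson(Δ_λ)` on the time interval `(0, T)`. -/
def poissonClass (lam : ℝ) (T : EReal) (p : ℝ≥0∞) : Set (ℝ → ℝ) :=
  {v | IsWeight v ∧ ∀ f : ℝ → ℝ, MemLp f p (weightMeasure v) →
    AbsConv lam (poissonKernel lam) T f ∧
    SmoothOn T (kernelIntegral lam (poissonKernel lam) f) ∧
    PoissonEq lam T (kernelIntegral lam (poissonKernel lam) f) ∧
    HasInitialData (kernelIntegral lam (poissonKernel lam) f) f}

/-- The integrability factor `φ_t^λ` of the heat problem. -/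
def heatFactor (lam t y : ℝ) : ℝ :=
  y ^ lam * (y / (y + 1)) ^ lam * Real.exp (-y ^ 2 / (4 * t))

/-- The integrability factor `φ^λ` of the Poisson problem. -/
def poissonFactor (lam y : ℝ) : ℝ :=
  y ^ (2 * lam) / (y ^ 2 + 1) ^ (lam + 1)

end Bessel

end

namespace Bessel

theorem integrable_smul_add_smul {Ω E : Type*} [MeasurableSpace Ω] {μ : Measure Ω}
    [NormedAddCommGroup E] [NormedSpace ℝ E] [CompleteSpace E] {f g : Ω → ℝ}
    (hf : Integrable f μ) (hg : Integrable g μ) (a b : E) :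
    Integrable (fun w => f w • a + g w • b) μ ∧
      ∫ w, f w • a + g w • b ∂μ = (∫ w, f w ∂μ) • a + (∫ w, g w ∂μ) • b := by
  refine ⟨(hf.smul_const a).add (hg.smul_const b), ?_⟩
  rw [integral_add (hf.smul_const a) (hg.smul_const b), integral_smul_const, integral_smul_const]

/-- Differentiation under the integral sign for a family of integrands indexed by `(j, k)` which
is stable under the two partial derivatives. -/
theorem hasFDerivAt_integral_of_family {Ω : Type*} [MeasurableSpace Ω] {μ : Measure Ω}
    {U : Set (ℝ × ℝ)} (hU : IsOpen U) {F : ℕ → ℕ → ℝ × ℝ → Ω → ℝ}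
    (hmeas : ∀ j k, ∀ q ∈ U, AEStronglyMeasurable (F j k q) μ)
    (hder : ∀ j k, ∀ᵐ w ∂μ, ∀ q ∈ U, HasFDerivAt (fun q => F j k q w)
      (F (j + 1) k q w • ContinuousLinearMap.fst ℝ ℝ ℝ
        + F j (k + 1) q w • ContinuousLinearMap.snd ℝ ℝ ℝ) q)
    (hdom : ∀ j k, ∀ q ∈ U, ∃ V ∈ 𝓝 q, ∃ bound : Ω → ℝ, Integrable bound μ ∧
      ∀ᵐ w ∂μ, ∀ q' ∈ V, |F j k q' w| ≤ bound w) (j k : ℕ) {q : ℝ × ℝ} (hq : q ∈ U) :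
    HasFDerivAt (fun q => ∫ w, F j k q w ∂μ)
      ((∫ w, F (j + 1) k q w ∂μ) • ContinuousLinearMap.fst ℝ ℝ ℝ
        + (∫ w, F j (k + 1) q w ∂μ) • ContinuousLinearMap.snd ℝ ℝ ℝ) q := by
  have hint : ∀ j k, Integrable (F j k q) μ := by
    intro j k
    obtain ⟨V, hV, b, hb, hle⟩ := hdom j k q hq
    refine hb.mono' (hmeas j k q hq) ?_
    filter_upwards [hle] with w h using h q (mem_of_mem_nhds hV)
  obtain ⟨V, hV, b, hb, hle⟩ := hdom (j + 1) k q hq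
  obtain ⟨V', hV', b', hb', hle'⟩ := hdom j (k + 1) q hq
  obtain ⟨h12, heq⟩ := integrable_smul_add_smul (hint (j + 1) k) (hint j (k + 1))
    (ContinuousLinearMap.fst ℝ ℝ ℝ) (ContinuousLinearMap.snd ℝ ℝ ℝ)
  have := hasFDerivAt_integral_of_dominated_of_fderiv_le (μ := μ) (F := F j k) (x₀ := q)
    (s := V ∩ V' ∩ U) (bound := fun w => b w + b' w)
    (F' := fun q w => F (j + 1) k q w • ContinuousLinearMap.fst ℝ ℝ ℝ
        + F j (k + 1) q w • ContinuousLinearMap.snd ℝ ℝ ℝ)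
    (inter_mem (inter_mem hV hV') (hU.mem_nhds hq))
    (by filter_upwards [hU.mem_nhds hq] with q' hq' using hmeas j k q' hq')
    (hint j k) h12.aestronglyMeasurable ?_ (hb.add hb') ?_
  · rwa [heq] at this
  · filter_upwards [hle, hle'] with w h h' q' hq'
    refine (norm_add_le _ _).trans (add_le_add ?_ ?_)
    · rw [norm_smul]
      exact (mul_le_of_le_one_right (norm_nonneg _)
        (ContinuousLinearMap.norm_fst_le ℝ ℝ ℝ)).trans (h q' hq'.1.1)
    · rw [norm_smul]
      exact (mul_le_of_le_one_right (norm_nonneg _)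
        (ContinuousLinearMap.norm_snd_le ℝ ℝ ℝ)).trans (h' q' hq'.1.2)
  · filter_upwards [hder j k] with w h q' hq' using h q' hq'.2

/-- A family of functions of two variables which is stable under partial derivatives consists of
smooth functions. -/
theorem contDiffOn_of_family {U : Set (ℝ × ℝ)} (hU : IsOpen U) {G : ℕ → ℕ → ℝ × ℝ → ℝ}
    (hG : ∀ j k, ∀ q ∈ U, HasFDerivAt (G j k) (G (j + 1) k q • ContinuousLinearMap.fst ℝ ℝ ℝ
        + G j (k + 1) q • ContinuousLinearMap.snd ℝ ℝ ℝ) q) (j k : ℕ) :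
    ContDiffOn ℝ ∞ (G j k) U := by
  rw [contDiffOn_infty]
  intro n
  induction n generalizing j k with
  | zero =>
    exact contDiffOn_zero.2 fun q hq => (hG j k q hq).continuousAt.continuousWithinAt
  | succ n ih =>
    have := contDiffOn_succ_iff_fderiv_of_isOpen (𝕜 := ℝ) (f := G j k) (n := (n : WithTop ℕ∞)) hU
    push_cast
    rw [this]
    refine ⟨fun q hq => (hG j k q hq).differentiableAt.differentiableWithinAt, by simp, ?_⟩
    refine ContDiffOn.congr (f := fun q => G (j + 1) k q • ContinuousLinearMap.fst ℝ ℝ ℝ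
        + G j (k + 1) q • ContinuousLinearMap.snd ℝ ℝ ℝ) ?_ fun q hq => (hG j k q hq).fderiv
    exact ((ih _ _).smul contDiffOn_const).add ((ih _ _).smul contDiffOn_const)

theorem eLpNorm_le_of_forall_integral_mul_le {α : Type*} [MeasurableSpace α] {μ : Measure α}
    [IsFiniteMeasure μ] {p q : ℝ≥0∞} [p.HolderConjugate q] (hp : p ≠ ⊤) {g : α → ℝ}
    (hg : Measurable g) (hg0 : ∀ x, 0 ≤ g x) {N : ℝ} (hN : ∀ᵐ x ∂μ, g x ≤ N) {C : ℝ}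
    (hC0 : 0 ≤ C)
    (hC : ∀ f : α → ℝ, MemLp f p μ → ∫ x, g x * f x ∂μ ≤ C * (eLpNorm f p μ).toReal) :
    eLpNorm g q μ ≤ ENNReal.ofReal C := by
  have hbd : ∀ r : ℝ≥0∞, MemLp g r μ := fun r =>
    MemLp.of_bound hg.aestronglyMeasurable N (by
      filter_upwards [hN] with x hx; rwa [Real.norm_of_nonneg (hg0 x)])
  have hp1 : 1 ≤ p := ENNReal.HolderConjugate.one_le p q
  by_cases hq : q = ⊤
  · have hp1' : p = 1 := (ENNReal.HolderConjugate.eq_top_iff_eq_one q p).1 hq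
    subst hq hp1'
    rw [eLpNorm_exponent_top]
    have hle : g ≤ᵐ[μ] fun _ => C := by
      refine ae_le_of_forall_setIntegral_le ((hbd 1).integrable le_rfl) (integrable_const C) ?_
      intro s hs _
      have h1 := hC (s.indicator fun _ => 1)
        (memLp_indicator_const 1 hs 1 (Or.inr (measure_ne_top _ _)))
      rw [eLpNorm_indicator_const hs one_ne_zero ENNReal.one_ne_top] at h1
      simp only [enorm_one, ENNReal.toReal_one, div_one, ENNReal.rpow_one, one_mul] at h1
      rw [setIntegral_const, smul_eq_mul, measureReal_def, mul_comm]
      convert h1 using 1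
      rw [← integral_indicator hs]
      congr 1; ext x; by_cases hx : x ∈ s <;> simp [hx]
    refine eLpNormEssSup_le_of_ae_bound ?_
    filter_upwards [hle] with x hx; rwa [Real.norm_of_nonneg (hg0 x)]
  · have hpr := ENNReal.HolderConjugate.toReal_of_ne_top (p := p) (q := q) hp hq
    set P := p.toReal
    set Q := q.toReal
    have hP0 := hpr.pos
    have hQ0 := hpr.symm.pos
    have hf : MemLp (fun x => g x ^ (Q - 1)) p μ := by
      refine MemLp.of_bound (hg.pow_const _).aestronglyMeasurable (N ^ (Q - 1)) ?_
      filter_upwards [hN] with x hx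
      rw [Real.norm_of_nonneg (Real.rpow_nonneg (hg0 x) _)]
      exact Real.rpow_le_rpow (hg0 x) hx hpr.symm.sub_one_pos.le
    have h1 := hC _ hf
    set A := ∫ x, g x ^ Q ∂μ with hA
    have hA0 : 0 ≤ A := integral_nonneg fun x => Real.rpow_nonneg (hg0 x) _
    have e1 : ∫ x, g x * g x ^ (Q - 1) ∂μ = A := by
      congr 1; ext x
      rcases (hg0 x).eq_or_lt with h | h
      · rw [← h, Real.zero_rpow hQ0.ne']; simp
      · rw [Real.rpow_sub_one h.ne']; field_simp
    have e2 : (eLpNorm (fun x => g x ^ (Q - 1)) p μ).toReal = A ^ (1 / P) := by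
      rw [hf.eLpNorm_eq_integral_rpow_norm (by rintro rfl; simp at hp1) hp,
        ENNReal.toReal_ofReal (by positivity), one_div]
      congr 2; ext x
      rw [Real.norm_of_nonneg (Real.rpow_nonneg (hg0 x) _), ← Real.rpow_mul (hg0 x)]
      congr 1
      exact hpr.symm.sub_one_mul_conj
    rw [e1, e2] at h1
    rw [(hbd q).eLpNorm_eq_integral_rpow_norm (by rintro rfl; simp [Q] at hQ0) hq]
    refine ENNReal.ofReal_le_ofReal ?_
    have : ∫ x, ‖g x‖ ^ Q ∂μ = A := by
      congr 1; ext x; rw [Real.norm_of_nonneg (hg0 x)]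
    rw [this]
    rcases hA0.eq_or_lt with h | h
    · rw [← h, Real.zero_rpow (by positivity)]; exact hC0
    · have h2 : A = A ^ Q⁻¹ * A ^ (1 / P) := by
        rw [← Real.rpow_add h, one_div, add_comm, hpr.inv_add_inv_eq_one, Real.rpow_one]
      have h3 : 0 < A ^ (1 / P) := Real.rpow_pos_of_pos h _
      exact le_of_mul_le_mul_right (h2 ▸ h1) h3

/-- Converse of Hölder's inequality, without an a priori bound. -/
theorem memLp_of_forall_integrable_mul {α : Type*} [MeasurableSpace α] {μ : Measure α}
    [SigmaFinite μ] {p q : ℝ≥0∞} [p.HolderConjugate q] (hp : p ≠ ⊤) {g : α → ℝ}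
    (hg : AEStronglyMeasurable g μ)
    (h : ∀ f : α → ℝ, MemLp f p μ → Integrable (fun x => g x * f x) μ) : MemLp g q μ := by
  obtain ⟨g₁, hg₁m, hg₁⟩ := hg
  have hp1 : 1 ≤ p := ENNReal.HolderConjugate.one_le p q
  have : Fact (1 ≤ p) := ⟨hp1⟩
  have : Fact (1 ≤ q) := ⟨ENNReal.HolderConjugate.one_le q p⟩
  refine (memLp_congr_ae hg₁).2 ?_
  replace h : ∀ f : α → ℝ, MemLp f p μ → Integrable (fun x => |g₁ x| * f x) μ := by
    intro f hf
    have h1 := h f hf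
    refine h1.norm.mono' (((hg₁m.measurable.norm).aestronglyMeasurable).mul hf.1) ?_
    filter_upwards [hg₁] with x hx
    simp [hx]
  set G : α → ℝ := fun x => |g₁ x| with hG
  have hGm : Measurable G := hg₁m.measurable.norm
  have hG0 : ∀ x, 0 ≤ G x := fun x => abs_nonneg _
  suffices hs : MemLp G q μ from
    hs.of_le hg₁m.aestronglyMeasurable (Eventually.of_forall fun x => by simp [hG])
  let E : ℕ → Set α := fun n => {x | G x ≤ n} ∩ spanningSets μ n
  have hE : ∀ n, MeasurableSet (E n) := fun n =>
    (measurableSet_le hGm measurable_const).inter (measurableSet_spanningSets μ n)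
  have hEfin : ∀ n, μ (E n) < ⊤ := fun n =>
    (measure_mono inter_subset_right).trans_lt (measure_spanningSets_lt_top μ n)
  have hGn : ∀ n, MemLp ((E n).indicator G) q μ := by
    intro n
    rw [memLp_indicator_iff_restrict (hE n)]
    have : IsFiniteMeasure (μ.restrict (E n)) := ⟨by simpa using hEfin n⟩
    refine MemLp.of_bound hGm.aestronglyMeasurable n ?_
    filter_upwards [ae_restrict_mem (hE n)] with x hx
    rw [Real.norm_of_nonneg (hG0 x)]; exact hx.1
  let Tn : ℕ → Lp ℝ p μ →L[ℝ] ℝ := fun n =>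
    (ContinuousLinearMap.mul ℝ ℝ).lpPairing μ q p (hGn n).toLp
  have hTn : ∀ n (f : Lp ℝ p μ), Tn n f = ∫ x in E n, G x * f x ∂μ := by
    intro n f
    simp only [Tn, ContinuousLinearMap.lpPairing_eq_integral]
    rw [← integral_indicator (hE n)]
    refine integral_congr_ae ?_
    filter_upwards [(hGn n).coeFn_toLp] with x hx
    rw [hx]; by_cases hxE : x ∈ E n <;> simp [hxE]
  obtain ⟨C, hC⟩ := banach_steinhaus (g := Tn) (by
    intro f
    refine ⟨∫ x, |G x * f x| ∂μ, fun n => ?_⟩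
    rw [hTn, Real.norm_eq_abs]
    have hi := (h f (Lp.memLp f)).abs
    exact (abs_integral_le_integral_abs).trans
      (setIntegral_le_integral hi (Eventually.of_forall fun x => abs_nonneg _)))
  have hC0 : 0 ≤ C := (norm_nonneg _).trans (hC 0)
  have hbound : ∀ n, eLpNorm ((E n).indicator G) q μ ≤ ENNReal.ofReal C := by
    intro n
    have : IsFiniteMeasure (μ.restrict (E n)) := ⟨by simpa using hEfin n⟩
    rw [eLpNorm_indicator_eq_eLpNorm_restrict (hE n)]
    refine eLpNorm_le_of_forall_integral_mul_le hp hGm hG0 (N := n) ?_ hC0 ?_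
    · filter_upwards [ae_restrict_mem (hE n)] with x hx using hx.1
    · intro f hf
      have hf' : MemLp ((E n).indicator f) p μ := (memLp_indicator_iff_restrict (hE n)).2 hf
      have h1 := (Tn n).le_opNorm hf'.toLp
      rw [hTn, Lp.norm_toLp, eLpNorm_indicator_eq_eLpNorm_restrict (hE n)] at h1
      have h2 : ∫ x in E n, G x * (MemLp.toLp _ hf' : Lp ℝ p μ) x ∂μ =
          ∫ x in E n, G x * f x ∂μ := by
        refine integral_congr_ae ?_
        filter_upwards [ae_restrict_of_ae hf'.coeFn_toLp, ae_restrict_mem (hE n)] with x hx hxE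
        rw [hx, indicator_of_mem hxE]
      rw [h2] at h1
      exact (le_abs_self _).trans (h1.trans
        (mul_le_mul_of_nonneg_right (hC n) ENNReal.toReal_nonneg))
  refine ⟨hGm.aestronglyMeasurable, lt_of_le_of_lt ?_ (ENNReal.ofReal_lt_top (r := C))⟩
  refine (Lp.eLpNorm_lim_le_liminf_eLpNorm
    (fun n => (hGm.indicator (hE n)).aestronglyMeasurable) G ?_).trans ?_
  · refine Eventually.of_forall fun x => tendsto_const_nhds.congr' ?_
    obtain ⟨k, hk⟩ := exists_nat_ge (G x)
    filter_upwards [eventually_ge_atTop k, eventually_ge_atTop (spanningSetsIndex μ x)] with n h1 h2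
    rw [indicator_of_mem]
    exact ⟨hk.trans (by exact_mod_cast h1), mem_spanningSets_of_index_le μ x h2⟩
  · exact liminf_le_of_le (by isBoundedDefault) fun b hb =>
      (hb.exists).elim fun n hn => hn.trans (hbound n)

theorem poissonProfile_le_tsum {τ r : ℝ} (hτ : 0 < τ) :
    ENNReal.ofReal (τ / (τ ^ 2 + r ^ 2)) ≤
      ∑' k : ℕ, ENNReal.ofReal (4 * (1 / 4) ^ k / τ) * (Iic (2 ^ k * τ)).indicator 1 r := by
  by_cases h : r ≤ τ
  · refine le_trans ?_ (ENNReal.le_tsum 0)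
    have : r ∈ Iic (2 ^ 0 * τ) := by simpa using h
    rw [indicator_of_mem this]
    simp only [pow_zero, mul_one, Pi.one_apply]
    refine ENNReal.ofReal_le_ofReal ?_
    rw [div_le_div_iff₀ (by positivity) hτ]
    nlinarith [sq_nonneg r, sq_nonneg τ]
  · push Not at h
    obtain ⟨k, hk1, hk2⟩ := exists_nat_pow_near (x := r / τ) (y := (2 : ℝ))
      ((one_le_div hτ).2 h.le) one_lt_two
    refine le_trans ?_ (ENNReal.le_tsum (k + 1))
    rw [le_div_iff₀ hτ] at hk1
    rw [div_lt_iff₀ hτ] at hk2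
    have : r ∈ Iic (2 ^ (k + 1) * τ) := hk2.le
    rw [indicator_of_mem this]
    simp only [mul_one, Pi.one_apply]
    refine ENNReal.ofReal_le_ofReal ?_
    have h4 : (1 / 4 : ℝ) ^ (k + 1) * 4 = 1 / 4 ^ k := by
      rw [pow_succ, one_div_pow]; ring
    rw [mul_comm, h4, div_div, div_le_div_iff₀ (by positivity) (by positivity)]
    have h5 : (2 ^ k * τ) ^ 2 ≤ r ^ 2 := by gcongr
    have h6 : (2 ^ k * τ) ^ 2 = 4 ^ k * τ ^ 2 := by
      rw [mul_pow, ← pow_mul, mul_comm k 2, pow_mul]; norm_num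
    nlinarith [sq_nonneg τ]

/-- Averages against the Poisson profile are controlled by averages over balls. -/
theorem lintegral_closedBall_mul_poissonProfile_le {h : ℝ → ℝ≥0∞} {x δ ε τ : ℝ}
    (hδ : 0 < δ) (hε : 0 ≤ ε) (hτ : 0 < τ)
    (hh : AEMeasurable h (volume.restrict (Metric.closedBall x δ)))
    (hle : ∀ r, 0 < r → r ≤ δ → ∫⁻ y in Metric.closedBall x r, h y ≤ ENNReal.ofReal (ε * r)) :
    ∫⁻ y in Metric.closedBall x δ, h y * ENNReal.ofReal (τ / (τ ^ 2 + (y - x) ^ 2)) ≤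
      ENNReal.ofReal (8 * ε) := by
  have hmeas : ∀ k : ℕ, Measurable fun y : ℝ =>
      ENNReal.ofReal (4 * (1 / 4) ^ k / τ) * (Iic (2 ^ k * τ)).indicator 1 |y - x| := by
    intro k
    refine measurable_const.mul ?_
    exact (measurable_one.indicator measurableSet_Iic).comp
      (measurable_norm.comp (measurable_id.sub_const x))
  calc ∫⁻ y in Metric.closedBall x δ, h y * ENNReal.ofReal (τ / (τ ^ 2 + (y - x) ^ 2))
      ≤ ∫⁻ y in Metric.closedBall x δ, ∑' k : ℕ, h y *
          (ENNReal.ofReal (4 * (1 / 4) ^ k / τ) * (Iic (2 ^ k * τ)).indicator 1 |y - x|) := by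
        refine lintegral_mono fun y => ?_
        rw [ENNReal.tsum_mul_left]
        gcongr
        rw [← sq_abs (y - x)]
        exact poissonProfile_le_tsum hτ
    _ = ∑' k : ℕ, ∫⁻ y in Metric.closedBall x δ, h y *
          (ENNReal.ofReal (4 * (1 / 4) ^ k / τ) * (Iic (2 ^ k * τ)).indicator 1 |y - x|) :=
        lintegral_tsum fun k => hh.mul (hmeas k).aemeasurable
    _ ≤ ∑' k : ℕ, ENNReal.ofReal (4 * ε * (1 / 2) ^ k) := by
        refine ENNReal.tsum_le_tsum fun k => ?_
        have hk : 0 < 2 ^ k * τ := by positivity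
        calc ∫⁻ y in Metric.closedBall x δ, h y *
              (ENNReal.ofReal (4 * (1 / 4) ^ k / τ) * (Iic (2 ^ k * τ)).indicator 1 |y - x|)
            = ∫⁻ y in Metric.closedBall x δ, ENNReal.ofReal (4 * (1 / 4) ^ k / τ) *
                (Metric.closedBall x (2 ^ k * τ)).indicator h y := by
              refine lintegral_congr fun y => ?_
              by_cases hy : |y - x| ≤ 2 ^ k * τ
              · have h1 : |y - x| ∈ Iic (2 ^ k * τ) := hy
                have h2 : y ∈ Metric.closedBall x (2 ^ k * τ) := by
                  rwa [Metric.mem_closedBall, Real.dist_eq]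
                rw [indicator_of_mem h1, indicator_of_mem h2]
                simp [mul_comm]
              · have h1 : |y - x| ∉ Iic (2 ^ k * τ) := hy
                have h2 : y ∉ Metric.closedBall x (2 ^ k * τ) := by
                  rwa [Metric.mem_closedBall, Real.dist_eq]
                rw [indicator_of_notMem h1, indicator_of_notMem h2]
                simp
          _ = ENNReal.ofReal (4 * (1 / 4) ^ k / τ) *
                ∫⁻ y in Metric.closedBall x (min (2 ^ k * τ) δ), h y := by
              rw [lintegral_const_mul' _ _ ENNReal.ofReal_ne_top,
                lintegral_indicator Metric.isClosed_closedBall.measurableSet,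
                Measure.restrict_restrict Metric.isClosed_closedBall.measurableSet]
              congr 3
              ext y
              simp [Metric.mem_closedBall]
          _ ≤ ENNReal.ofReal (4 * (1 / 4) ^ k / τ) * ENNReal.ofReal (ε * (2 ^ k * τ)) := by
              gcongr
              refine (hle _ (lt_min hk hδ) (min_le_right _ _)).trans ?_
              gcongr
              exact min_le_left _ _
          _ = ENNReal.ofReal (4 * ε * (1 / 2) ^ k) := by
              rw [← ENNReal.ofReal_mul (by positivity)]
              congr 1
              have : (1 / 4 : ℝ) ^ k * 2 ^ k = (1 / 2) ^ k := by rw [← mul_pow]; norm_num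
              rw [← this]; field_simp
    _ = ENNReal.ofReal (8 * ε) := by
        rw [← ENNReal.ofReal_tsum_of_nonneg (fun k => by positivity)
          (summable_geometric_two.mul_left _), tsum_mul_left, tsum_geometric_two]
        ring_nf

/-- `x` is a Lebesgue point of `f`. -/
def IsLebesguePoint (f : ℝ → ℝ) (x : ℝ) : Prop :=
  ∀ ε > 0, ∃ δ > 0, ∀ r, 0 < r → r ≤ δ →
    ∫⁻ y in Metric.closedBall x r, ‖f y - f x‖ₑ ≤ ENNReal.ofReal (ε * r)

theorem ae_isLebesguePoint {f : ℝ → ℝ} (hf : ∀ a b, 0 < a → IntegrableOn f (Icc a b)) :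
    ∀ᵐ x ∂(volume.restrict (Ioi (0 : ℝ))), IsLebesguePoint f x := by
  let g : ℕ → ℝ → ℝ := fun n => (Icc (1 / ((n : ℝ) + 1)) (n + 1)).indicator f
  have hg : ∀ n, Integrable (g n) := fun n =>
    (hf _ _ (by positivity)).integrable_indicator measurableSet_Icc
  have h1 : ∀ᵐ x : ℝ, ∀ n, ∀ {ι : Type} {l : Filter ι} (w : ι → ℝ) (δ : ι → ℝ),
      Tendsto δ l (𝓝[>] 0) → (∀ᶠ j in l, x ∈ Metric.closedBall (w j) (1 * δ j)) →
      Tendsto (fun j => ⨍ y in Metric.closedBall (w j) (δ j), ‖g n y - g n x‖) l (𝓝 0) :=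
    ae_all_iff.2 fun n =>
      IsUnifLocDoublingMeasure.ae_tendsto_average_norm_sub volume (hg n).locallyIntegrable 1
  filter_upwards [ae_restrict_of_ae h1, ae_restrict_mem measurableSet_Ioi] with x hx hx0 ε hε
  have hx0 : 0 < x := hx0
  obtain ⟨n, hn⟩ := exists_nat_gt (max (1 / x) x)
  have hn1 : 1 / ((n : ℝ) + 1) < x := by
    rw [div_lt_iff₀ (by positivity), ← div_lt_iff₀' hx0]
    exact (le_max_left _ _).trans_lt (hn.trans (lt_add_one _))
  have hn2 : x < (n : ℝ) + 1 := (le_max_right _ _).trans_lt (hn.trans (lt_add_one _))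
  have ht := hx n (fun _ : ℝ => x) id tendsto_id (by
    filter_upwards [self_mem_nhdsWithin] with r hr
    simpa using le_of_lt hr)
  have hev := ht.eventually (gt_mem_nhds (show (0 : ℝ) < ε / 2 by positivity))
  rw [eventually_nhdsWithin_iff, Metric.eventually_nhds_iff] at hev
  obtain ⟨δ, hδ, hev⟩ := hev
  refine ⟨min (δ / 2) (min (x - 1 / ((n : ℝ) + 1)) (n + 1 - x)), ?_, ?_⟩
  · refine lt_min (by positivity) (lt_min (by linarith) (by linarith))
  intro r hr hrle
  have hr1 : r ≤ δ / 2 := hrle.trans (min_le_left _ _)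
  have hr2 := hrle.trans ((min_le_right _ _).trans (min_le_left _ _))
  have hr3 := hrle.trans ((min_le_right _ _).trans (min_le_right _ _))
  have h2 := hev (y := r) (by rw [Real.dist_eq, sub_zero, abs_of_pos hr]; linarith) hr
  have hgf : ∀ y ∈ Metric.closedBall x r, g n y = f y := by
    intro y hy
    rw [Metric.mem_closedBall, Real.dist_eq, abs_le] at hy
    have hmem : y ∈ Icc (1 / ((n : ℝ) + 1)) (n + 1) := ⟨by linarith [hy.1], by linarith [hy.2]⟩
    exact indicator_of_mem hmem f
  have hball : MeasurableSet (Metric.closedBall x r) := Metric.isClosed_closedBall.measurableSet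
  have hint : IntegrableOn (fun y => g n y - g n x) (Metric.closedBall x r) :=
    (hg n).integrableOn.sub (integrableOn_const measure_closedBall_lt_top.ne)
  rw [setLIntegral_congr_fun (g := fun y => ‖g n y - g n x‖ₑ) hball (fun y hy => by
    simp only [hgf y hy, hgf x (Metric.mem_closedBall_self hr.le)])]
  rw [← ofReal_integral_norm_eq_lintegral_enorm hint]
  refine ENNReal.ofReal_le_ofReal ?_
  rw [id, setAverage_eq, measureReal_def, Real.volume_closedBall,
    ENNReal.toReal_ofReal (by positivity), smul_eq_mul, inv_mul_lt_iff₀ (by positivity)] at h2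
  linarith

/-- A nonnegative kernel of total mass one, with a Poisson type majorant near `x` and vanishing
mass far from `x`, is an approximate identity at the Lebesgue points. -/
theorem tendsto_integral_mul_of_isLebesguePoint {f : ℝ → ℝ} {x : ℝ} (hx : 0 < x)
    (hf : AEStronglyMeasurable f (volume.restrict (Ioi (0 : ℝ)))) (hL : IsLebesguePoint f x)
    {K : ℝ → ℝ → ℝ} {τ : ℝ → ℝ} {C : ℝ} (hC : 0 ≤ C)
    (hK0 : ∀ᶠ t in 𝓝[>] (0 : ℝ), ∀ y, 0 < y → 0 ≤ K t y)
    (hτ : ∀ᶠ t in 𝓝[>] (0 : ℝ), 0 < τ t)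
    (hKi : ∀ᶠ t in 𝓝[>] (0 : ℝ), IntegrableOn (K t) (Ioi 0))
    (hKfi : ∀ᶠ t in 𝓝[>] (0 : ℝ), IntegrableOn (fun y => K t y * f y) (Ioi 0))
    (hK1 : ∀ᶠ t in 𝓝[>] (0 : ℝ), ∫ y in Ioi (0 : ℝ), K t y = 1)
    (hnear : ∀ᶠ t in 𝓝[>] (0 : ℝ), ∀ y, 0 < y → y ≤ 2 * x →
      K t y ≤ C * (τ t / (τ t ^ 2 + (y - x) ^ 2)))
    (hfar : ∀ δ > 0, ∃ (η : ℝ → ℝ) (Φ : ℝ → ℝ), Tendsto η (𝓝[>] 0) (𝓝 0) ∧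
      IntegrableOn Φ (Ioi 0) ∧ IntegrableOn (fun y => Φ y * f y) (Ioi 0) ∧
      ∀ᶠ t in 𝓝[>] (0 : ℝ), ∀ y, 0 < y → δ < |y - x| → K t y ≤ η t * Φ y) :
    Tendsto (fun t => ∫ y in Ioi (0 : ℝ), K t y * f y) (𝓝[>] 0) (𝓝 (f x)) := by
  rw [EMetric.tendsto_nhds]
  intro e he
  obtain ⟨e', he'0, he'⟩ := ENNReal.lt_iff_exists_nnreal_btwn.1 he
  have he'0 : (0 : ℝ) < e' := by exact_mod_cast he'0
  obtain ⟨δ₀, hδ₀, hL⟩ := hL (e' / (16 * (C + 1))) (by positivity)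
  set δ := min δ₀ (x / 2) with hδdef
  have hδ : 0 < δ := lt_min hδ₀ (by positivity)
  have hδx : δ ≤ x / 2 := min_le_right _ _
  obtain ⟨η, Φ, hη, hΦ, hΦf, hfar⟩ := hfar δ hδ
  have hΦg : IntegrableOn (fun y => Φ y * (f y - f x)) (Ioi 0) := by
    simp_rw [mul_sub]; exact hΦf.sub (hΦ.mul_const _)
  have hM : ∫⁻ y in Ioi 0, ‖Φ y * (f y - f x)‖ₑ ≠ ⊤ := hΦg.2.ne
  set M := ∫⁻ y in Ioi 0, ‖Φ y * (f y - f x)‖ₑ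
  have hηM : ∀ᶠ t in 𝓝[>] (0 : ℝ), ‖η t‖ₑ * M < ENNReal.ofReal (e' / 2) := by
    have h1 : Tendsto (fun t => ‖η t‖ₑ * M) (𝓝[>] 0) (𝓝 (‖(0 : ℝ)‖ₑ * M)) :=
      ENNReal.Tendsto.mul_const hη.enorm (Or.inr hM)
    rw [enorm_zero, zero_mul] at h1
    exact h1.eventually (gt_mem_nhds (by simpa using he'0))
  filter_upwards [hK0, hτ, hKi, hKfi, hK1, hnear, hfar, hηM]
    with t hK0 hτ hKi hKfi hK1 hnear hfar hηM
  have hball : MeasurableSet (Metric.closedBall x δ) := Metric.isClosed_closedBall.measurableSet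
  have hsub : Metric.closedBall x δ ⊆ Ioi 0 := by
    intro y hy
    rw [Metric.mem_closedBall, Real.dist_eq, abs_le] at hy
    exact show 0 < y by linarith [hy.1]
  have hdiff : (∫ y in Ioi (0 : ℝ), K t y * f y) - f x =
      ∫ y in Ioi (0 : ℝ), K t y * (f y - f x) := by
    simp_rw [mul_sub]
    rw [integral_sub hKfi (hKi.mul_const _), integral_mul_const, hK1, one_mul]
  rw [edist_eq_enorm_sub, hdiff]
  have hbig : ∫⁻ y in Ioi (0 : ℝ), ‖K t y * (f y - f x)‖ₑ ≤
      ENNReal.ofReal (e' / 2) + ENNReal.ofReal (e' / 2) := by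
    rw [← lintegral_inter_add_sdiff _ (Ioi (0 : ℝ)) hball, inter_eq_self_of_subset_right hsub]
    gcongr
    · calc ∫⁻ y in Metric.closedBall x δ, ‖K t y * (f y - f x)‖ₑ
          ≤ ∫⁻ y in Metric.closedBall x δ, ENNReal.ofReal C * (‖f y - f x‖ₑ *
              ENNReal.ofReal (τ t / (τ t ^ 2 + (y - x) ^ 2))) := by
            refine setLIntegral_mono' hball fun y hy => ?_
            have hy0 : 0 < y := hsub hy
            rw [Metric.mem_closedBall, Real.dist_eq, abs_le] at hy
            have h1 := hnear y hy0 (by linarith [hy.2])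
            rw [enorm_mul, mul_comm ‖f y - f x‖ₑ, ← mul_assoc, ← ENNReal.ofReal_mul hC,
              Real.enorm_of_nonneg (hK0 y hy0)]
            gcongr
        _ ≤ ENNReal.ofReal C * ENNReal.ofReal (8 * (e' / (16 * (C + 1)))) := by
            rw [lintegral_const_mul' _ _ ENNReal.ofReal_ne_top]
            gcongr
            refine lintegral_closedBall_mul_poissonProfile_le hδ (by positivity) hτ ?_ ?_
            · exact ((hf.mono_measure (Measure.restrict_mono hsub le_rfl)).sub
                aestronglyMeasurable_const).enorm
            · exact fun r hr hrδ => hL r hr (hrδ.trans (min_le_left _ _))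
        _ ≤ ENNReal.ofReal (e' / 2) := by
            rw [← ENNReal.ofReal_mul hC]
            refine ENNReal.ofReal_le_ofReal ?_
            have : C * (8 * (e' / (16 * (C + 1)))) = e' / 2 * (C / (C + 1)) := by
              field_simp; ring
            rw [this]
            exact mul_le_of_le_one_right (by positivity) (by
              rw [div_le_one (by positivity)]; linarith)
    · refine le_trans ?_ hηM.le
      calc ∫⁻ y in Ioi 0 \ Metric.closedBall x δ, ‖K t y * (f y - f x)‖ₑ
          ≤ ∫⁻ y in Ioi 0 \ Metric.closedBall x δ, ‖η t‖ₑ * ‖Φ y * (f y - f x)‖ₑ := by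
            refine setLIntegral_mono' (measurableSet_Ioi.diff hball) fun y hy => ?_
            have hy0 : 0 < y := hy.1
            have h1 : δ < |y - x| := by
              have := hy.2
              rwa [Metric.mem_closedBall, Real.dist_eq, not_le] at this
            have h2 := hfar y hy0 h1
            rw [← enorm_mul (η t), ← mul_assoc (η t), enorm_mul (K t y), enorm_mul (η t * Φ y)]
            gcongr ?_ * _
            rw [enorm_le_iff_norm_le, Real.norm_of_nonneg (hK0 y hy0)]
            exact h2.trans (le_abs_self _)
        _ ≤ ∫⁻ y in Ioi 0, ‖η t‖ₑ * ‖Φ y * (f y - f x)‖ₑ := lintegral_mono_set sdiff_subset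
        _ = ‖η t‖ₑ * M := lintegral_const_mul' _ _ enorm_ne_top
  refine ((enorm_integral_le_lintegral_enorm _).trans hbig).trans_lt ?_
  rw [← ENNReal.ofReal_add (by positivity) (by positivity), add_halves, ENNReal.ofReal_coe_nnreal]
  exact he'

/-- The probability measure on `[-1, 1]` with density proportional to `(1 - s²)^{λ-1}`, or
`(δ₁ + δ₋₁) / 2` for `λ = 0`, described by the properties which are used. -/
structure IsAngularMeasure (lam : ℝ) (m : Measure ℝ) : Prop where
  prob : IsProbabilityMeasure m
  mem : ∀ᵐ s ∂m, s ∈ Icc (-1 : ℝ) 1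
  odd : ∫ s, s ∂m = 0
  ibp : ∀ g g' : ℝ → ℝ, (∀ s ∈ Icc (-1 : ℝ) 1, HasDerivAt g (g' s) s) →
    ContinuousOn g' (Icc (-1 : ℝ) 1) →
    ∫ s, (1 - s ^ 2) * g' s ∂m = 2 * lam * ∫ s, s * g s ∂m
  decay : ∃ C, 0 ≤ C ∧ ∀ z, 0 < z → ∫ s, Real.exp (-(z * (1 - s))) ∂m ≤ C * z ^ (-lam)

theorem isAngularMeasure_zero :
    IsAngularMeasure 0 ((2⁻¹ : ℝ≥0∞) • (Measure.dirac (1 : ℝ) + Measure.dirac (-1))) := by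
  have hint : ∀ h : ℝ → ℝ, ∫ s, h s ∂((2⁻¹ : ℝ≥0∞) • (Measure.dirac (1 : ℝ) + Measure.dirac (-1)))
      = 2⁻¹ * (h 1 + h (-1)) := by
    intro h
    rw [integral_smul_measure, integral_add_measure (integrable_dirac (by simp))
      (integrable_dirac (by simp))]
    simp
  refine ⟨⟨?_⟩, ?_, ?_, ?_, 1, zero_le_one, ?_⟩
  · simp only [Measure.smul_apply, Measure.add_apply, measure_univ, smul_eq_mul]
    rw [one_add_one_eq_two, ENNReal.inv_mul_cancel (by simp) (by simp)]
  · refine Measure.ae_smul_measure ?_ _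
    rw [ae_add_measure_iff]
    constructor <;> rw [ae_dirac_eq] <;> simp
  · rw [hint]; simp
  · intro g g' _ _
    rw [hint]; simp
  · intro z hz
    rw [hint, neg_zero, Real.rpow_zero]
    have : Real.exp (-(z * (1 - -1))) ≤ 1 := Real.exp_le_one_iff.2 (by nlinarith)
    simp only [sub_self, mul_zero, neg_zero, Real.exp_zero, mul_one]
    calc (2⁻¹ : ℝ) * (1 + Real.exp (-(z * (1 - -1)))) ≤ 2⁻¹ * (1 + 1) := by gcongr
      _ = 1 := by norm_num

theorem angularDensity_le {lam z s : ℝ} (hlam : 0 < lam) (hz : 0 ≤ z) (hs : s ∈ Ioo (-1 : ℝ) 1) :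
    (1 - s ^ 2) ^ (lam - 1) * Real.exp (-(z * (1 - s))) ≤
      2 ^ lam * ((1 - s) ^ (lam - 1) * Real.exp (-(z * (1 - s)))
        + (s + 1) ^ (lam - 1) * Real.exp (-(z * (s + 1)))) := by
  obtain ⟨h1, h2⟩ := hs
  have key : ∀ r : ℝ, 0 ≤ r → r < 1 → (1 + r) ^ (lam - 1) ≤ 2 ^ lam := fun r hr hr1 =>
    (Real.rpow_le_rpow_of_exponent_le (by linarith) (by linarith)).trans
      (Real.rpow_le_rpow (by linarith) (by linarith) hlam.le)
  have e : (1 - s ^ 2) ^ (lam - 1) = (1 - s) ^ (lam - 1) * (s + 1) ^ (lam - 1) := by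
    rw [← Real.mul_rpow (by linarith) (by linarith)]; congr 1; ring
  have p1 : 0 ≤ (1 - s) ^ (lam - 1) := Real.rpow_nonneg (by linarith) _
  have p2 : 0 ≤ (s + 1) ^ (lam - 1) := Real.rpow_nonneg (by linarith) _
  have p3 : (0 : ℝ) ≤ 2 ^ lam := by positivity
  have p4 := (Real.exp_pos (-(z * (1 - s)))).le
  have p5 := (Real.exp_pos (-(z * (s + 1)))).le
  rw [e]
  rcases le_or_gt 0 s with h | h
  · have := key s h h2
    rw [add_comm] at this
    calc _ = (s + 1) ^ (lam - 1) * ((1 - s) ^ (lam - 1) * Real.exp (-(z * (1 - s)))) := by ring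
      _ ≤ 2 ^ lam * ((1 - s) ^ (lam - 1) * Real.exp (-(z * (1 - s)))) := by gcongr
      _ ≤ _ := by gcongr; exact le_add_of_nonneg_right (by positivity)
  · have := key (-s) (by linarith) (by linarith)
    rw [← sub_eq_add_neg] at this
    calc _ = (1 - s) ^ (lam - 1) * ((s + 1) ^ (lam - 1) * Real.exp (-(z * (1 - s)))) := by ring
      _ ≤ 2 ^ lam * ((s + 1) ^ (lam - 1) * Real.exp (-(z * (s + 1)))) := by
        gcongr; linarith
      _ ≤ _ := by gcongr; exact le_add_of_nonneg_left (by positivity)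

theorem intervalIntegrable_rpow_mul_exp {lam : ℝ} (hlam : 0 < lam) (z : ℝ) :
    IntervalIntegrable (fun r => r ^ (lam - 1) * Real.exp (-(z * r))) volume 0 2 :=
  (intervalIntegral.intervalIntegrable_rpow' (by linarith)).mul_continuousOn (by fun_prop)

theorem intervalIntegrable_angularMajorant {lam : ℝ} (hlam : 0 < lam) (z : ℝ) :
    IntervalIntegrable (fun s => (1 - s) ^ (lam - 1) * Real.exp (-(z * (1 - s)))) volume (-1) 1 ∧
    IntervalIntegrable (fun s => (s + 1) ^ (lam - 1) * Real.exp (-(z * (s + 1))))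
      volume (-1) 1 := by
  have h := intervalIntegrable_rpow_mul_exp hlam z
  constructor
  · have := (h.comp_sub_left 1).symm
    norm_num at this
    exact this
  · have := h.comp_add_right 1
    norm_num at this
    exact this

theorem intervalIntegrable_angularDensity {lam : ℝ} (hlam : 0 < lam) :
    IntervalIntegrable (fun s : ℝ => (1 - s ^ 2) ^ (lam - 1)) volume (-1) 1 := by
  obtain ⟨h1, h2⟩ := intervalIntegrable_angularMajorant hlam 0
  have h3 := (h1.add h2).const_mul (2 ^ lam)
  rw [intervalIntegrable_iff_integrableOn_Ioo_of_le (by norm_num)] at h3 ⊢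
  refine h3.mono' (Measurable.aestronglyMeasurable (by fun_prop)) ?_
  filter_upwards [ae_restrict_mem measurableSet_Ioo] with s hs
  have := angularDensity_le hlam le_rfl hs
  rw [Real.norm_of_nonneg (Real.rpow_nonneg (by nlinarith [hs.1, hs.2]) _)]
  simpa using this

theorem integral_rpow_mul_exp_le {lam z : ℝ} (hlam : 0 < lam) (hz : 0 < z) :
    ∫ r in (0 : ℝ)..2, r ^ (lam - 1) * Real.exp (-(z * r)) ≤ Real.Gamma lam * z ^ (-lam) := by
  have h := Real.integral_rpow_mul_exp_neg_mul_Ioi hlam hz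
  rw [one_div, Real.inv_rpow hz.le, ← Real.rpow_neg hz.le, mul_comm] at h
  rw [← h, intervalIntegral.integral_of_le (by norm_num)]
  have hint : IntegrableOn (fun r => r ^ (lam - 1) * Real.exp (-(z * r))) (Ioi 0) := by
    have := integrableOn_rpow_mul_exp_neg_mul_rpow (p := 1) (s := lam - 1) (b := z) (by linarith)
      one_pos hz
    simpa [neg_mul] using this
  refine setIntegral_mono_set hint ?_ (Ioc_subset_Ioi_self).eventuallyLE
  filter_upwards [ae_restrict_mem measurableSet_Ioi] with r hr
  have hr : 0 < r := hr
  positivity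

theorem integral_angularDensity_mul_exp_le {lam z : ℝ} (hlam : 0 < lam) (hz : 0 < z) :
    ∫ s in (-1 : ℝ)..1, (1 - s ^ 2) ^ (lam - 1) * Real.exp (-(z * (1 - s))) ≤
      2 ^ lam * (2 * Real.Gamma lam) * z ^ (-lam) := by
  obtain ⟨h1, h2⟩ := intervalIntegrable_angularMajorant hlam z
  have h3 := (h1.add h2).const_mul (2 ^ lam)
  have h4 : IntervalIntegrable (fun s : ℝ => (1 - s ^ 2) ^ (lam - 1) * Real.exp (-(z * (1 - s))))
      volume (-1) 1 :=
    (intervalIntegrable_angularDensity hlam).mul_continuousOn (by fun_prop)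
  calc _ ≤ ∫ s in (-1 : ℝ)..1, 2 ^ lam * ((1 - s) ^ (lam - 1) * Real.exp (-(z * (1 - s)))
        + (s + 1) ^ (lam - 1) * Real.exp (-(z * (s + 1)))) :=
        intervalIntegral.integral_mono_on_of_le_Ioo (by norm_num) h4 h3
          fun s hs => angularDensity_le hlam hz.le hs
    _ = 2 ^ lam * ((∫ r in (0 : ℝ)..2, r ^ (lam - 1) * Real.exp (-(z * r)))
        + ∫ r in (0 : ℝ)..2, r ^ (lam - 1) * Real.exp (-(z * r))) := by
        rw [intervalIntegral.integral_const_mul, intervalIntegral.integral_add h1 h2,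
          intervalIntegral.integral_comp_sub_left
            (fun r => r ^ (lam - 1) * Real.exp (-(z * r))) 1,
          intervalIntegral.integral_comp_add_right
            (fun r => r ^ (lam - 1) * Real.exp (-(z * r))) 1]
        norm_num
    _ ≤ _ := by
        have := integral_rpow_mul_exp_le hlam hz
        have h2 : (0 : ℝ) ≤ 2 ^ lam := by positivity
        nlinarith

theorem integral_angularDensity_ibp {lam : ℝ} (hlam : 0 < lam) {g g' : ℝ → ℝ}
    (hg : ∀ s ∈ Icc (-1 : ℝ) 1, HasDerivAt g (g' s) s) (hg' : ContinuousOn g' (Icc (-1 : ℝ) 1)) :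
    ∫ s in (-1 : ℝ)..1, (1 - s ^ 2) ^ (lam - 1) * ((1 - s ^ 2) * g' s) =
      2 * lam * ∫ s in (-1 : ℝ)..1, (1 - s ^ 2) ^ (lam - 1) * (s * g s) := by
  have hw := intervalIntegrable_angularDensity hlam
  have hu : uIcc (-1 : ℝ) 1 = Icc (-1) 1 := uIcc_of_le (by norm_num)
  have hgc : ContinuousOn g (Icc (-1 : ℝ) 1) := fun s hs =>
    (hg s hs).continuousAt.continuousWithinAt
  have i1 : IntervalIntegrable (fun s : ℝ => (1 - s ^ 2) ^ (lam - 1) * ((1 - s ^ 2) * g' s))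
      volume (-1) 1 := hw.mul_continuousOn (by rw [hu]; fun_prop)
  have i2 : IntervalIntegrable (fun s : ℝ => (1 - s ^ 2) ^ (lam - 1) * (s * g s))
      volume (-1) 1 := hw.mul_continuousOn (by rw [hu]; fun_prop)
  have h := intervalIntegral.integral_eq_sub_of_hasDerivAt_of_le (a := -1) (b := 1) (by norm_num)
    (f := fun s => (1 - s ^ 2) ^ lam * g s)
    (f' := fun s => (1 - s ^ 2) ^ (lam - 1) * ((1 - s ^ 2) * g' s)
      - 2 * lam * ((1 - s ^ 2) ^ (lam - 1) * (s * g s))) ?_ ?_ (i1.sub (i2.const_mul _))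
  · rw [intervalIntegral.integral_sub i1 (i2.const_mul _),
      intervalIntegral.integral_const_mul] at h
    simp only [one_pow, even_two, Even.neg_pow, sub_self, Real.zero_rpow hlam.ne', zero_mul] at h
    linarith
  · refine ContinuousOn.mul ?_ hgc
    exact ContinuousOn.rpow_const (by fun_prop) fun s _ => Or.inr hlam.le
  · intro s hs
    have hpos : 0 < 1 - s ^ 2 := by nlinarith [hs.1, hs.2]
    have h1 : HasDerivAt (fun s : ℝ => 1 - s ^ 2) (-(2 * s)) s := by
      simpa using (hasDerivAt_pow 2 s).const_sub 1
    have h2 := (h1.rpow_const (p := lam) (Or.inl hpos.ne')).mul (hg s (Ioo_subset_Icc_self hs))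
    refine h2.congr_deriv ?_
    rw [Real.rpow_sub_one hpos.ne']
    field_simp
    ring

theorem exists_isAngularMeasure {lam : ℝ} (hlam : 0 ≤ lam) : ∃ m, IsAngularMeasure lam m := by
  rcases hlam.eq_or_lt with rfl | hlam
  · exact ⟨_, isAngularMeasure_zero⟩
  set w : ℝ → ℝ := fun s => (1 - s ^ 2) ^ (lam - 1) with hw
  have hwi := intervalIntegrable_angularDensity hlam
  have hwi' : IntegrableOn w (Ioo (-1) 1) :=
    (intervalIntegrable_iff_integrableOn_Ioo_of_le (by norm_num)).1 hwi
  have hwpos : ∀ s ∈ Ioo (-1 : ℝ) 1, 0 < w s := fun s hs =>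
    Real.rpow_pos_of_pos (by nlinarith [hs.1, hs.2]) _
  set c := ∫ s in (-1 : ℝ)..1, w s with hc
  have hc0 : 0 < c := intervalIntegral.intervalIntegral_pos_of_pos_on hwi hwpos (by norm_num)
  have hwm : Measurable w := by simp only [hw]; fun_prop
  let m : Measure ℝ := (volume.restrict (Ioo (-1 : ℝ) 1)).withDensity
    fun s => ENNReal.ofReal (w s / c)
  have hm : ∀ h : ℝ → ℝ, ∫ s, h s ∂m = c⁻¹ * ∫ s in (-1 : ℝ)..1, w s * h s := by
    intro h
    rw [integral_withDensity_eq_integral_toReal_smul (by fun_prop) (by simp),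
      intervalIntegral.integral_of_le (by norm_num), integral_Ioc_eq_integral_Ioo,
      ← integral_const_mul]
    refine setIntegral_congr_fun measurableSet_Ioo fun s hs => ?_
    have := hwpos s hs
    simp only [smul_eq_mul]
    rw [ENNReal.toReal_ofReal (by positivity)]
    field_simp
  refine ⟨m, ⟨⟨?_⟩, ?_, ?_, ?_, c⁻¹ * (2 ^ lam * (2 * Real.Gamma lam)), ?_, ?_⟩⟩
  · rw [withDensity_apply _ MeasurableSet.univ, Measure.restrict_univ,
      ← ofReal_integral_eq_lintegral_ofReal (hwi'.div_const c)]
    · rw [integral_div, ← integral_Ioc_eq_integral_Ioo,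
        ← intervalIntegral.integral_of_le (by norm_num), ← hc, div_self hc0.ne',
        ENNReal.ofReal_one]
    · filter_upwards [ae_restrict_mem measurableSet_Ioo] with s hs
      exact div_nonneg (hwpos s hs).le hc0.le
  · refine (withDensity_absolutelyContinuous _ _).ae_le ?_
    filter_upwards [ae_restrict_mem measurableSet_Ioo] with s hs using Ioo_subset_Icc_self hs
  · have := integral_angularDensity_ibp hlam (g := fun _ => 1) (g' := fun _ => 0)
      (fun s _ => hasDerivAt_const s 1) continuousOn_const
    simp only [mul_zero, intervalIntegral.integral_zero, mul_one] at this
    rw [hm]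
    have h0 : ∫ s in (-1 : ℝ)..1, w s * s = 0 := by
      rcases mul_eq_zero.1 this.symm with h | h
      · linarith
      · exact h
    rw [h0, mul_zero]
  · intro g g' hg hg'
    rw [hm, hm, integral_angularDensity_ibp hlam hg hg']
    ring
  · have := Real.Gamma_pos_of_pos hlam
    positivity
  · intro z hz
    rw [hm, mul_assoc]
    gcongr
    exact integral_angularDensity_mul_exp_le hlam hz

namespace IsAngularMeasure

variable {lam : ℝ} {m : Measure ℝ}

theorem integrable (hm : IsAngularMeasure lam m) {g : ℝ → ℝ}
    (hg : ContinuousOn g (Icc (-1 : ℝ) 1)) : Integrable g m := by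
  have := hm.prob
  rw [← Measure.restrict_eq_self_of_ae_mem hm.mem]
  exact hg.integrableOn_compact isCompact_Icc

theorem moment_add_two (hm : IsAngularMeasure lam m) (n : ℕ) :
    (n + 1 + 2 * lam) * ∫ s, s ^ (n + 2) ∂m = (n + 1) * ∫ s, s ^ n ∂m := by
  have h := hm.ibp (fun s => s ^ (n + 1)) (fun s => (n + 1) * s ^ n)
    (fun s _ => by simpa using hasDerivAt_pow (n + 1) s) (by fun_prop)
  have e1 : ∀ s : ℝ, (1 - s ^ 2) * ((n + 1) * s ^ n) = (n + 1) * s ^ n - (n + 1) * s ^ (n + 2) :=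
    fun s => by ring
  have e2 : ∀ s : ℝ, s * s ^ (n + 1) = s ^ (n + 2) := fun s => by ring
  simp_rw [e1, e2] at h
  rw [integral_sub ((hm.integrable (by fun_prop)).const_mul _)
    ((hm.integrable (by fun_prop)).const_mul _), integral_const_mul, integral_const_mul] at h
  linarith

theorem moment_odd (hm : IsAngularMeasure lam m) (hlam : 0 ≤ lam) (k : ℕ) :
    ∫ s, s ^ (2 * k + 1) ∂m = 0 := by
  induction k with
  | zero => simpa using hm.odd
  | succ k ih =>
    have h := hm.moment_add_two (2 * k + 1)
    rw [ih, mul_zero] at h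
    have h0 : ((2 * k + 1 : ℕ) : ℝ) + 1 + 2 * lam ≠ 0 := by positivity
    exact (mul_eq_zero.1 h).resolve_left h0

theorem moment_even (hm : IsAngularMeasure lam m) (hlam : 0 ≤ lam) (k : ℕ) :
    (∫ s, s ^ (2 * k) ∂m) / (2 * k).factorial =
      Real.Gamma (lam + 1 / 2) / (4 ^ k * k.factorial * Real.Gamma (k + lam + 1 / 2)) := by
  have := hm.prob
  induction k with
  | zero =>
    have : Real.Gamma (lam + 1 / 2) ≠ 0 := (Real.Gamma_pos_of_pos (by positivity)).ne'
    simp only [mul_zero, pow_zero, Nat.factorial_zero, Nat.cast_one, Nat.cast_zero, zero_add,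
      one_mul, div_self this]
    simp
  | succ k ih =>
    have h := hm.moment_add_two (2 * k)
    have hG : Real.Gamma ((k + 1 : ℕ) + lam + 1 / 2)
        = (k + lam + 1 / 2) * Real.Gamma (k + lam + 1 / 2) := by
      rw [← Real.Gamma_add_one (by positivity)]; congr 1; push_cast; ring
    have hG0 : 0 < Real.Gamma (k + lam + 1 / 2) := Real.Gamma_pos_of_pos (by positivity)
    have hf : (0 : ℝ) < k.factorial := by positivity
    have hf2 : (0 : ℝ) < (2 * k).factorial := by positivity
    have e : 2 * (k + 1) = 2 * k + 1 + 1 := by ring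
    rw [hG, e, Nat.factorial_succ, Nat.factorial_succ, Nat.factorial_succ]
    have e3 : ∫ s, s ^ (2 * k + 1 + 1) ∂m
        = (2 * k + 1) / (2 * k + 1 + 2 * lam) * ∫ s, s ^ (2 * k) ∂m := by
      rw [div_mul_eq_mul_div, eq_div_iff (by positivity), mul_comm]
      push_cast at h; exact h
    rw [div_eq_iff hf2.ne'] at ih
    rw [e3, ih]
    have : (2 * (k : ℝ) + 1 + 2 * lam) ≠ 0 := by positivity
    push_cast
    field_simp
    ring

theorem hasSum_integral_exp (hm : IsAngularMeasure lam m) (hlam : 0 ≤ lam) (z : ℝ) :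
    HasSum (fun k : ℕ => Real.Gamma (lam + 1 / 2) /
      (4 ^ k * k.factorial * Real.Gamma (k + lam + 1 / 2)) * z ^ (2 * k))
      (∫ s, Real.exp (z * s) ∂m) := by
  have := hm.prob
  have h := hasSum_integral_of_summable_integral_norm (μ := m)
    (F := fun (n : ℕ) s => (z * s) ^ n / n.factorial)
    (fun n => hm.integrable (by fun_prop)) (by
      refine Summable.of_nonneg_of_le (fun n => integral_nonneg fun s => norm_nonneg _)
        (fun n => ?_) (Real.summable_pow_div_factorial |z|)
      calc ∫ s, ‖(z * s) ^ n / (n.factorial : ℝ)‖ ∂m ≤ ∫ s, |z| ^ n / n.factorial ∂m := by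
            refine integral_mono_ae (hm.integrable (by fun_prop)) (integrable_const _) ?_
            filter_upwards [hm.mem] with s hs
            rw [norm_div, norm_pow, norm_mul, Real.norm_eq_abs, Real.norm_eq_abs,
              Real.norm_of_nonneg (Nat.cast_nonneg _)]
            gcongr
            exact mul_le_of_le_one_right (abs_nonneg _) (abs_le.2 hs)
        _ = |z| ^ n / n.factorial := by simp)
  have e : ∀ s, ∑' n : ℕ, (z * s) ^ n / (n.factorial : ℝ) = Real.exp (z * s) := fun s => by
    rw [Real.exp_eq_exp_ℝ, NormedSpace.exp_eq_tsum_div]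
  simp_rw [e] at h
  have hinj : Function.Injective fun k : ℕ => 2 * k := fun a b h => by simpa using h
  rw [← hinj.hasSum_iff] at h
  · refine (congrArg (fun F => HasSum F _) (funext fun k => ?_)).mp h
    simp only [Function.comp]
    rw [← hm.moment_even hlam, integral_div]
    simp_rw [mul_pow]
    rw [integral_const_mul]
    ring
  · intro n hn
    obtain ⟨k, rfl⟩ : Odd n := by
      rw [← Nat.not_even_iff_odd]
      rintro ⟨k, rfl⟩
      exact hn ⟨k, by ring⟩
    rw [integral_div]
    simp_rw [mul_pow]
    rw [integral_const_mul, hm.moment_odd hlam, mul_zero, zero_div]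

theorem besselI_eq (hm : IsAngularMeasure lam m) (hlam : 0 ≤ lam) {z : ℝ} (hz : 0 < z) :
    besselI (lam - 1 / 2) z =
      (z / 2) ^ (lam - 1 / 2) / Real.Gamma (lam + 1 / 2) * ∫ s, Real.exp (z * s) ∂m := by
  rw [← (hm.hasSum_integral_exp hlam z).tsum_eq, besselI, ← tsum_mul_left]
  congr 1
  ext k
  have hG : 0 < Real.Gamma (lam + 1 / 2) := Real.Gamma_pos_of_pos (by positivity)
  have hG' : 0 < Real.Gamma (k + lam + 1 / 2) := Real.Gamma_pos_of_pos (by positivity)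
  have e1 : (k : ℝ) + (lam - 1 / 2) + 1 = k + lam + 1 / 2 := by ring
  have e2 : (z / 2) ^ (2 * (k : ℝ) + (lam - 1 / 2)) =
      (z / 2) ^ (lam - 1 / 2) * (z ^ (2 * k) / 4 ^ k) := by
    rw [add_comm, Real.rpow_add (by positivity)]
    congr 1
    have : (2 * (k : ℝ)) = ((2 * k : ℕ) : ℝ) := by push_cast; ring
    rw [this, Real.rpow_natCast, div_pow, pow_mul 2 2 k]
    norm_num
  rw [e1, e2]
  field_simp

end IsAngularMeasure

/-- The normalizing constant of the heat kernel. -/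
noncomputable def heatConst (lam : ℝ) : ℝ := 4 ^ (-lam) / Real.Gamma (lam + 1 / 2)

theorem heatConst_pos {lam : ℝ} (hlam : 0 ≤ lam) : 0 < heatConst lam :=
  div_pos (by positivity) (Real.Gamma_pos_of_pos (by positivity))

namespace IsAngularMeasure

variable {lam : ℝ} {m : Measure ℝ}

theorem heatKernel_eq_exp_mul (hm : IsAngularMeasure lam m) (hlam : 0 ≤ lam) {t x y : ℝ}
    (ht : 0 < t) (hx : 0 < x) (hy : 0 < y) :
    heatKernel lam t x y = heatConst lam * t ^ (-lam - 1 / 2) *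
      Real.exp (-(x ^ 2 + y ^ 2) / (4 * t)) * ∫ s, Real.exp (x * y / (2 * t) * s) ∂m := by
  have hz : 0 < x * y / (2 * t) := by positivity
  rw [heatKernel, hm.besselI_eq hlam hz, heatConst]
  have e : (x * y) ^ (-lam + 1 / 2) / (2 * t) * (x * y / (2 * t) / 2) ^ (lam - 1 / 2) =
      4 ^ (-lam) * t ^ (-lam - 1 / 2) := by
    have h1 : x * y / (2 * t) / 2 = x * y * (4 * t)⁻¹ := by field_simp; norm_num
    have h2 : -lam + 1 / 2 = -(lam - 1 / 2) := by ring
    have hxy : 0 < x * y := by positivity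
    have h4 : (0 : ℝ) < 4 ^ (lam - 1 / 2) := by positivity
    have ht4 : 0 < t ^ (lam - 1 / 2) := by positivity
    rw [h1, h2, Real.mul_rpow hxy.le (by positivity), Real.rpow_neg hxy.le,
      Real.inv_rpow (by positivity), Real.mul_rpow (by norm_num) ht.le]
    have h3 : t ^ (-lam - 1 / 2) = (t ^ (lam - 1 / 2))⁻¹ * t⁻¹ := by
      rw [← Real.rpow_neg ht.le, ← Real.rpow_neg_one t, ← Real.rpow_add ht]; congr 1; ring
    have h5 : (4 : ℝ) ^ (-lam) = (4 ^ (lam - 1 / 2))⁻¹ * 2⁻¹ := by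
      rw [← Real.rpow_neg (by norm_num)]
      have : (2⁻¹ : ℝ) = 4 ^ (-(1 / 2) : ℝ) := by
        rw [show (4 : ℝ) = 2 ^ (2 : ℝ) by norm_num, ← Real.rpow_mul (by norm_num)]
        norm_num [Real.rpow_neg_one]
      rw [this, ← Real.rpow_add (by norm_num)]; congr 1; ring
    rw [h3, h5]
    have : 0 < (x * y) ^ (lam - 1 / 2) := by positivity
    field_simp
  rw [div_mul_eq_mul_div (4 ^ (-lam)) _ (t ^ (-lam - 1 / 2)), ← e]
  ring

theorem heatKernel_eq (hm : IsAngularMeasure lam m) (hlam : 0 ≤ lam) {t x y : ℝ}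
    (ht : 0 < t) (hx : 0 < x) (hy : 0 < y) :
    heatKernel lam t x y = heatConst lam * t ^ (-lam - 1 / 2) *
      ∫ s, Real.exp (-(x ^ 2 + y ^ 2 - 2 * x * y * s) / (4 * t)) ∂m := by
  rw [hm.heatKernel_eq_exp_mul hlam ht hx hy, mul_assoc, ← integral_const_mul]
  congr 2
  ext s
  rw [← Real.exp_add]
  congr 1
  field_simp
  ring

theorem le_heatKernel (hm : IsAngularMeasure lam m) (hlam : 0 ≤ lam) {t x y : ℝ}
    (ht : 0 < t) (hx : 0 < x) (hy : 0 < y) :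
    heatConst lam * t ^ (-lam - 1 / 2) * Real.exp (-(x ^ 2 + y ^ 2) / (4 * t)) ≤
      heatKernel lam t x y := by
  have := hm.prob
  rw [hm.heatKernel_eq_exp_mul hlam ht hx hy]
  have := heatConst_pos hlam
  refine le_mul_of_one_le_right (by positivity) ?_
  calc (1 : ℝ) = ∫ s, 1 + x * y / (2 * t) * s ∂m := by
        rw [integral_add (integrable_const _) ((hm.integrable (by fun_prop)).const_mul _),
          integral_const_mul, hm.odd]
        simp
    _ ≤ _ := by
        refine integral_mono (hm.integrable (by fun_prop)) (hm.integrable (by fun_prop)) ?_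
        intro s
        simpa [add_comm] using Real.add_one_le_exp (x * y / (2 * t) * s)

theorem heatKernel_nonneg (hm : IsAngularMeasure lam m) (hlam : 0 ≤ lam) {t x y : ℝ}
    (ht : 0 < t) (hx : 0 < x) (hy : 0 < y) : 0 ≤ heatKernel lam t x y := by
  have := heatConst_pos hlam
  exact le_trans (by positivity) (hm.le_heatKernel hlam ht hx hy)

theorem heatKernel_eq_exp_sub_sq (hm : IsAngularMeasure lam m) (hlam : 0 ≤ lam) {t x y : ℝ}
    (ht : 0 < t) (hx : 0 < x) (hy : 0 < y) :
    heatKernel lam t x y = heatConst lam * t ^ (-lam - 1 / 2) *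
      Real.exp (-(y - x) ^ 2 / (4 * t)) * ∫ s, Real.exp (-(x * y / (2 * t) * (1 - s))) ∂m := by
  rw [hm.heatKernel_eq hlam ht hx hy, mul_assoc _ (Real.exp (-(y - x) ^ 2 / (4 * t))),
    ← integral_const_mul (Real.exp (-(y - x) ^ 2 / (4 * t)))]
  congr 2
  ext s
  rw [← Real.exp_add]
  congr 1
  field_simp
  ring

theorem heatKernel_le (hm : IsAngularMeasure lam m) (hlam : 0 ≤ lam) {t x y : ℝ}
    (ht : 0 < t) (hx : 0 < x) (hy : 0 < y) :
    heatKernel lam t x y ≤ heatConst lam * t ^ (-lam - 1 / 2) *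
      Real.exp (-(y - x) ^ 2 / (4 * t)) := by
  have := hm.prob
  rw [hm.heatKernel_eq_exp_sub_sq hlam ht hx hy]
  have := heatConst_pos hlam
  refine mul_le_of_le_one_right (by positivity) ?_
  calc _ ≤ ∫ s, (1 : ℝ) ∂m := by
        refine integral_mono_ae (hm.integrable (by fun_prop)) (integrable_const _) ?_
        filter_upwards [hm.mem] with s hs
        refine Real.exp_le_one_iff.2 (neg_nonpos.2 (mul_nonneg (by positivity) ?_))
        linarith [hs.2]
    _ = 1 := by simp

theorem exists_heatKernel_mul_le (hm : IsAngularMeasure lam m) (hlam : 0 ≤ lam) :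
    ∃ C, 0 ≤ C ∧ ∀ t x y, 0 < t → 0 < x → 0 < y → y ≤ 2 * x →
      heatKernel lam t x y * y ^ (2 * lam) ≤
        C * (t ^ (-(1 / 2) : ℝ) * Real.exp (-(y - x) ^ 2 / (4 * t))) := by
  obtain ⟨C, hC, hdec⟩ := hm.decay
  have hc := heatConst_pos hlam
  refine ⟨heatConst lam * C * 2 ^ lam * 2 ^ lam, by positivity, ?_⟩
  intro t x y ht hx hy hyx
  have hz : 0 < x * y / (2 * t) := by positivity
  rw [hm.heatKernel_eq_exp_sub_sq hlam ht hx hy]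
  have hp : (x * y / (2 * t)) ^ (-lam) * y ^ (2 * lam) * t ^ (-lam - 1 / 2) =
      2 ^ lam * (y / x) ^ lam * t ^ (-(1 / 2) : ℝ) := by
    have e1 : y ^ (2 * lam) = y ^ lam * y ^ lam := by rw [two_mul, Real.rpow_add hy]
    have e2 : t ^ (-lam - 1 / 2) = (t ^ lam)⁻¹ * t ^ (-(1 / 2) : ℝ) := by
      rw [← Real.rpow_neg ht.le, ← Real.rpow_add ht]; congr 1
    rw [Real.rpow_neg hz.le, Real.div_rpow (by positivity) (by positivity),
      Real.mul_rpow hx.le hy.le, Real.mul_rpow (by norm_num) ht.le, e1, e2,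
      Real.div_rpow hy.le hx.le]
    have := Real.rpow_pos_of_pos hx lam
    have := Real.rpow_pos_of_pos hy lam
    have := Real.rpow_pos_of_pos ht lam
    field_simp
  have hyx' : (y / x) ^ lam ≤ 2 ^ lam :=
    Real.rpow_le_rpow (by positivity) ((div_le_iff₀ hx).2 hyx) hlam
  calc _ ≤ heatConst lam * t ^ (-lam - 1 / 2) * Real.exp (-(y - x) ^ 2 / (4 * t)) *
        (C * (x * y / (2 * t)) ^ (-lam)) * y ^ (2 * lam) := by
        gcongr
        exact hdec _ hz
    _ = heatConst lam * C * Real.exp (-(y - x) ^ 2 / (4 * t)) *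
        ((x * y / (2 * t)) ^ (-lam) * y ^ (2 * lam) * t ^ (-lam - 1 / 2)) := by ring
    _ = heatConst lam * C * 2 ^ lam * (y / x) ^ lam *
        (t ^ (-(1 / 2) : ℝ) * Real.exp (-(y - x) ^ 2 / (4 * t))) := by rw [hp]; ring
    _ ≤ _ := by gcongr

/-- The heat semigroup is conservative. -/
theorem integral_heatKernel (hm : IsAngularMeasure lam m) (hlam : 0 ≤ lam) {t x : ℝ}
    (ht : 0 < t) (hx : 0 < x) :
    IntegrableOn (fun y => heatKernel lam t x y * y ^ (2 * lam)) (Ioi 0) ∧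
      ∫ y in Ioi (0 : ℝ), heatKernel lam t x y * y ^ (2 * lam) = 1 := by
  have hc := heatConst_pos hlam
  have hG : 0 < Real.Gamma (lam + 1 / 2) := Real.Gamma_pos_of_pos (by positivity)
  set a : ℕ → ℝ := fun k => Real.Gamma (lam + 1 / 2) /
      (4 ^ k * k.factorial * Real.Gamma (k + lam + 1 / 2)) with ha
  have hGk : ∀ k : ℕ, 0 < Real.Gamma (k + lam + 1 / 2) := fun k =>
    Real.Gamma_pos_of_pos (by positivity)
  have ha0 : ∀ k, 0 ≤ a k := fun k => by have := hGk k; positivity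
  set B := heatConst lam * t ^ (-lam - 1 / 2) * Real.exp (-x ^ 2 / (4 * t)) with hB
  set F : ℕ → ℝ → ℝ := fun k y => B * (a k * (x / (2 * t)) ^ (2 * k)) *
    (y ^ (2 * (k : ℝ) + 2 * lam) * Real.exp (-(1 / (4 * t)) * y ^ (2 : ℝ))) with hF
  have hFi : ∀ k, IntegrableOn (F k) (Ioi 0) := fun k =>
    (integrableOn_rpow_mul_exp_neg_mul_rpow
      (by linarith [show (0 : ℝ) ≤ 2 * k + 2 * lam by positivity]) two_pos
      (by positivity)).const_mul _
  have hF0 : ∀ k, ∀ y ∈ Ioi (0 : ℝ), 0 ≤ F k y := fun k y hy => by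
    have hy : 0 < y := hy
    have := ha0 k
    simp only [hF]; positivity
  have hFint : ∀ k, ∫ y in Ioi (0 : ℝ), F k y =
      Real.exp (-x ^ 2 / (4 * t)) * ((x ^ 2 / (4 * t)) ^ k / k.factorial) := by
    intro k
    simp only [hF]
    rw [integral_const_mul, integral_rpow_mul_exp_neg_mul_rpow two_pos
      (by linarith [show (0 : ℝ) ≤ 2 * k + 2 * lam by positivity]) (by positivity)]
    have e1 : (2 * (k : ℝ) + 2 * lam + 1) / 2 = k + lam + 1 / 2 := by ring
    have e2 : -(2 * (k : ℝ) + 2 * lam + 1) / 2 = -(k + lam + 1 / 2) := by ring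
    have e3 : (1 / (4 * t)) ^ (-(k + lam + 1 / 2)) =
        4 ^ k * t ^ k * 4 ^ lam * 2 * (t ^ (-lam - 1 / 2))⁻¹ := by
      rw [one_div, Real.inv_rpow (by positivity), ← Real.rpow_neg (by positivity), neg_neg,
        Real.mul_rpow (by norm_num) ht.le, ← Real.rpow_neg ht.le, neg_sub, sub_neg_eq_add,
        add_assoc, Real.rpow_add (by norm_num), Real.rpow_add ht, Real.rpow_natCast,
        Real.rpow_natCast, Real.rpow_add (by norm_num), add_comm (1 / 2) lam]
      have : (4 : ℝ) ^ (1 / 2 : ℝ) = 2 := by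
        rw [show (4 : ℝ) = 2 ^ (2 : ℝ) by norm_num, ← Real.rpow_mul (by norm_num)]
        norm_num
      rw [this]; ring
    rw [e1, e2, e3, hB, heatConst, ha]
    have := hGk k
    have h4 : (0 : ℝ) < 4 ^ lam := by positivity
    have ht' : 0 < t ^ (-lam - 1 / 2) := by positivity
    rw [Real.rpow_neg (by norm_num)]
    have e4 : (x / (2 * t)) ^ (2 * k) = (x ^ 2 / (4 * t)) ^ k / t ^ k := by
      rw [pow_mul, ← div_pow]; congr 1; field_simp; norm_num
    rw [e4]
    field_simp
  have hsumF : ∀ y ∈ Ioi (0 : ℝ),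
      HasSum (fun k => F k y) (heatKernel lam t x y * y ^ (2 * lam)) := by
    intro y hy
    have hy : 0 < y := hy
    have h := (hm.hasSum_integral_exp hlam (x * y / (2 * t))).mul_left
      (B * Real.exp (-y ^ 2 / (4 * t)) * y ^ (2 * lam))
    have e0 : B * Real.exp (-y ^ 2 / (4 * t)) * y ^ (2 * lam) *
        ∫ s, Real.exp (x * y / (2 * t) * s) ∂m = heatKernel lam t x y * y ^ (2 * lam) := by
      rw [hm.heatKernel_eq_exp_mul hlam ht hx hy, hB]
      have : Real.exp (-(x ^ 2 + y ^ 2) / (4 * t)) =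
          Real.exp (-x ^ 2 / (4 * t)) * Real.exp (-y ^ 2 / (4 * t)) := by
        rw [← Real.exp_add]; congr 1; ring
      rw [this]; ring
    rw [e0] at h
    refine (congrArg (fun F => HasSum F _) (funext fun k => ?_)).mp h
    · simp only [hF]
      have e1 : y ^ (2 * (k : ℝ) + 2 * lam) = y ^ (2 * k) * y ^ (2 * lam) := by
        rw [Real.rpow_add hy]; congr 1
        have : (2 * (k : ℝ)) = ((2 * k : ℕ) : ℝ) := by push_cast; ring
        rw [this, Real.rpow_natCast]
      have e2 : -(1 / (4 * t)) * y ^ (2 : ℝ) = -y ^ 2 / (4 * t) := by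
        rw [Real.rpow_two]; ring
      have e3 : (x * y / (2 * t)) ^ (2 * k) = (x / (2 * t)) ^ (2 * k) * y ^ (2 * k) := by
        rw [← mul_pow]; congr 1; ring
      rw [e1, e2, e3]; ring
  have hsexp : HasSum (fun k : ℕ => Real.exp (-x ^ 2 / (4 * t)) *
      ((x ^ 2 / (4 * t)) ^ k / k.factorial)) 1 := by
    have h := NormedSpace.expSeries_div_hasSum_exp (𝔸 := ℝ) (x ^ 2 / (4 * t))
    rw [← Real.exp_eq_exp_ℝ] at h
    have h2 := h.mul_left (Real.exp (-x ^ 2 / (4 * t)))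
    rwa [← Real.exp_add, ← add_div, neg_add_cancel, zero_div, Real.exp_zero] at h2
  have hnorm : Summable fun k => ∫ y in Ioi (0 : ℝ), ‖F k y‖ := by
    refine hsexp.summable.congr fun k => ?_
    rw [← hFint k]
    refine setIntegral_congr_fun measurableSet_Ioi fun y hy => ?_
    exact (Real.norm_of_nonneg (hF0 k y hy)).symm
  have heq : EqOn (fun y => ∑' k, F k y) (fun y => heatKernel lam t x y * y ^ (2 * lam)) (Ioi 0) :=
    fun y hy => (hsumF y hy).tsum_eq
  have h1 := hasSum_integral_of_summable_integral_norm hFi hnorm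
  rw [setIntegral_congr_fun measurableSet_Ioi heq] at h1
  simp_rw [hFint] at h1
  have hval := h1.unique hsexp
  refine ⟨?_, hval⟩
  by_contra hni
  rw [integral_undef hni] at hval
  exact zero_ne_one hval

end IsAngularMeasure

theorem integral_rpow_mul_exp_neg_div {a A : ℝ} (ha : 0 < a) (hA : 0 < A) :
    IntegrableOn (fun s => s ^ (-a - 1) * Real.exp (-A / (4 * s))) (Ioi 0) ∧
      ∫ s in Ioi (0 : ℝ), s ^ (-a - 1) * Real.exp (-A / (4 * s)) =
        (4 / A) ^ a * Real.Gamma a := by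
  set g : ℝ → ℝ := fun r => r ^ (a - 1) * Real.exp (-(A / 4 * r)) with hg
  have he : EqOn (fun s : ℝ => (|(-1 : ℝ)| * s ^ ((-1 : ℝ) - 1)) • g (s ^ (-1 : ℝ)))
      (fun s => s ^ (-a - 1) * Real.exp (-A / (4 * s))) (Ioi 0) := by
    intro s hs
    have hs : 0 < s := hs
    simp only [hg, abs_neg, abs_one, one_mul, smul_eq_mul]
    rw [← Real.rpow_mul hs.le, ← mul_assoc, ← Real.rpow_add hs, Real.rpow_neg_one]
    congr 2
    · ring
    · field_simp
  have hgi : IntegrableOn g (Ioi 0) := by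
    have := integrableOn_rpow_mul_exp_neg_mul_rpow (p := 1) (s := a - 1) (b := A / 4) (by linarith)
      one_pos (by positivity)
    simpa [neg_mul, hg] using this
  constructor
  · exact ((integrableOn_Ioi_comp_rpow_iff g (by norm_num : (-1 : ℝ) ≠ 0)).2 hgi).congr_fun he
      measurableSet_Ioi
  · rw [← setIntegral_congr_fun measurableSet_Ioi he,
      integral_comp_rpow_Ioi g (by norm_num : (-1 : ℝ) ≠ 0),
      Real.integral_rpow_mul_exp_neg_mul_Ioi ha (by positivity)]
    simp

/-- The normalizing constant of the Poisson kernel. -/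
noncomputable def poissonConst (lam : ℝ) : ℝ :=
  heatConst lam * 4 ^ (lam + 1) * Real.Gamma (lam + 1) / √(4 * Real.pi)

theorem poissonConst_pos {lam : ℝ} (hlam : 0 ≤ lam) : 0 < poissonConst lam := by
  have := heatConst_pos hlam
  have := Real.Gamma_pos_of_pos (show 0 < lam + 1 by positivity)
  have := Real.pi_pos
  unfold poissonConst
  positivity

theorem poissonPhase_bounds {t x y s : ℝ} (hx : 0 < x) (hy : 0 < y) (hs : s ∈ Icc (-1 : ℝ) 1) :
    t ^ 2 + (y - x) ^ 2 ≤ t ^ 2 + x ^ 2 + y ^ 2 - 2 * x * y * s ∧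
      t ^ 2 + x ^ 2 + y ^ 2 - 2 * x * y * s ≤ t ^ 2 + (x + y) ^ 2 := by
  have hxy : 0 < x * y := by positivity
  constructor <;> nlinarith [hs.1, hs.2]

namespace IsAngularMeasure

variable {lam : ℝ} {m : Measure ℝ}

theorem ae_prod_mem (hm : IsAngularMeasure lam m) :
    ∀ᵐ w : ℝ × ℝ ∂((volume.restrict (Ioi (0 : ℝ))).prod m), 0 < w.1 ∧ w.2 ∈ Icc (-1 : ℝ) 1 := by
  have := hm.prob
  filter_upwards [Measure.quasiMeasurePreserving_fst.ae (ae_restrict_mem measurableSet_Ioi),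
    Measure.quasiMeasurePreserving_snd.ae hm.mem] with w h1 h2 using ⟨h1, h2⟩

theorem poissonKernel_eq (hm : IsAngularMeasure lam m) (hlam : 0 ≤ lam) {t x y : ℝ}
    (ht : 0 < t) (hx : 0 < x) (hy : 0 < y) :
    poissonKernel lam t x y = poissonConst lam * t *
      ∫ s, (t ^ 2 + x ^ 2 + y ^ 2 - 2 * x * y * s) ^ (-lam - 1) ∂m := by
  have := hm.prob
  have h1 : ∫ s in Ioi (0 : ℝ), Real.exp (-t ^ 2 / (4 * s)) * heatKernel lam s x y / s ^ (3 / 2 : ℝ)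
      = heatConst lam * ∫ s in Ioi (0 : ℝ), ∫ r, s ^ (-(lam + 1) - 1) *
        Real.exp (-(t ^ 2 + x ^ 2 + y ^ 2 - 2 * x * y * r) / (4 * s)) ∂m := by
    rw [← integral_const_mul]
    refine setIntegral_congr_fun measurableSet_Ioi fun s hs => ?_
    have hs : 0 < s := hs
    rw [hm.heatKernel_eq hlam hs hx hy, integral_const_mul]
    have e1 : s ^ (-(lam + 1) - 1) = s ^ (-lam - 1 / 2) / s ^ (3 / 2 : ℝ) := by
      rw [← Real.rpow_sub hs]; congr 1; ring
    have e2 : ∫ r, Real.exp (-(t ^ 2 + x ^ 2 + y ^ 2 - 2 * x * y * r) / (4 * s)) ∂m =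
        Real.exp (-t ^ 2 / (4 * s)) *
          ∫ r, Real.exp (-(x ^ 2 + y ^ 2 - 2 * x * y * r) / (4 * s)) ∂m := by
      rw [← integral_const_mul]
      congr 1; ext r
      rw [← Real.exp_add]; congr 1; ring
    rw [e1, e2]; ring
  have hint : Integrable (Function.uncurry fun s r : ℝ => s ^ (-(lam + 1) - 1) *
      Real.exp (-(t ^ 2 + x ^ 2 + y ^ 2 - 2 * x * y * r) / (4 * s)))
      ((volume.restrict (Ioi (0 : ℝ))).prod m) := by
    have hb := (integral_rpow_mul_exp_neg_div (a := lam + 1) (A := t ^ 2) (by positivity)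
      (by positivity)).1
    refine Integrable.mono' (hb.comp_fst m) ?_ ?_
    · refine Measurable.aestronglyMeasurable ?_
      unfold Function.uncurry
      fun_prop
    · filter_upwards [hm.ae_prod_mem] with w hw
      obtain ⟨hw1, hw2⟩ := hw
      have h := (poissonPhase_bounds (t := t) hx hy hw2).1
      simp only [Function.uncurry]
      rw [Real.norm_of_nonneg (by positivity)]
      gcongr
      nlinarith [sq_nonneg (y - x)]
  rw [poissonKernel, h1, integral_integral_swap hint]
  have h2 : ∫ r, (∫ s in Ioi (0 : ℝ), s ^ (-(lam + 1) - 1) *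
        Real.exp (-(t ^ 2 + x ^ 2 + y ^ 2 - 2 * x * y * r) / (4 * s))) ∂m =
      ∫ r, 4 ^ (lam + 1) * Real.Gamma (lam + 1) *
        (t ^ 2 + x ^ 2 + y ^ 2 - 2 * x * y * r) ^ (-lam - 1) ∂m := by
    refine integral_congr_ae ?_
    filter_upwards [hm.mem] with r hr
    have h := (poissonPhase_bounds (t := t) hx hy hr).1
    have hA : 0 < t ^ 2 + x ^ 2 + y ^ 2 - 2 * x * y * r :=
      lt_of_lt_of_le (by positivity) h
    rw [(integral_rpow_mul_exp_neg_div (a := lam + 1) (by positivity) hA).2,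
      Real.div_rpow (by norm_num) hA.le, show -lam - 1 = -(lam + 1) by ring, Real.rpow_neg hA.le]
    ring
  rw [h2, integral_const_mul, poissonConst]
  ring

theorem continuousOn_poissonPhase_rpow {t x y : ℝ} (a : ℝ) (ht : 0 < t) (hx : 0 < x) (hy : 0 < y) :
    ContinuousOn (fun s : ℝ => (t ^ 2 + x ^ 2 + y ^ 2 - 2 * x * y * s) ^ a) (Icc (-1) 1) := by
  refine ContinuousOn.rpow_const (by fun_prop) fun s hs => Or.inl ?_
  exact (lt_of_lt_of_le (by positivity) (poissonPhase_bounds (t := t) hx hy hs).1).ne'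

theorem poissonKernel_le (hm : IsAngularMeasure lam m) (hlam : 0 ≤ lam) {t x y : ℝ}
    (ht : 0 < t) (hx : 0 < x) (hy : 0 < y) :
    poissonKernel lam t x y ≤ poissonConst lam * t * (t ^ 2 + (y - x) ^ 2) ^ (-lam - 1) := by
  have := hm.prob
  have := poissonConst_pos hlam
  rw [hm.poissonKernel_eq hlam ht hx hy]
  gcongr
  calc _ ≤ ∫ s, (t ^ 2 + (y - x) ^ 2) ^ (-lam - 1) ∂m := by
        refine integral_mono_ae (hm.integrable (continuousOn_poissonPhase_rpow _ ht hx hy))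
          (integrable_const _) ?_
        filter_upwards [hm.mem] with s hs
        exact Real.rpow_le_rpow_of_nonpos (by positivity) (poissonPhase_bounds hx hy hs).1
          (by linarith)
    _ = _ := by simp

theorem le_poissonKernel (hm : IsAngularMeasure lam m) (hlam : 0 ≤ lam) {t x y : ℝ}
    (ht : 0 < t) (hx : 0 < x) (hy : 0 < y) :
    poissonConst lam * t * (t ^ 2 + (x + y) ^ 2) ^ (-lam - 1) ≤ poissonKernel lam t x y := by
  have := hm.prob
  have := poissonConst_pos hlam
  rw [hm.poissonKernel_eq hlam ht hx hy]
  gcongr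
  calc _ = ∫ s, (t ^ 2 + (x + y) ^ 2) ^ (-lam - 1) ∂m := by simp
    _ ≤ _ := by
        refine integral_mono_ae (integrable_const _)
          (hm.integrable (continuousOn_poissonPhase_rpow _ ht hx hy)) ?_
        filter_upwards [hm.mem] with s hs
        have h := poissonPhase_bounds (t := t) hx hy hs
        exact Real.rpow_le_rpow_of_nonpos (lt_of_lt_of_le (by positivity) h.1) h.2 (by linarith)

theorem poissonKernel_nonneg (hm : IsAngularMeasure lam m) (hlam : 0 ≤ lam) {t x y : ℝ}
    (ht : 0 < t) (hx : 0 < x) (hy : 0 < y) : 0 ≤ poissonKernel lam t x y := by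
  have := poissonConst_pos hlam
  exact le_trans (by positivity) (hm.le_poissonKernel hlam ht hx hy)

theorem exists_poissonKernel_mul_le (hm : IsAngularMeasure lam m) (hlam : 0 ≤ lam) :
    ∃ C, 0 ≤ C ∧ ∀ t x y, 0 < t → 0 < x → 0 < y → y ≤ 2 * x →
      poissonKernel lam t x y * y ^ (2 * lam) ≤ C * (t / (t ^ 2 + (y - x) ^ 2)) := by
  obtain ⟨C, hC, hle⟩ := hm.exists_heatKernel_mul_le hlam
  refine ⟨1 / √(4 * Real.pi) * (C * 4), by positivity, ?_⟩
  intro t x y ht hx hy hyx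
  have hA : 0 < t ^ 2 + (y - x) ^ 2 := by positivity
  obtain ⟨hi, he⟩ := integral_rpow_mul_exp_neg_div (a := 1) one_pos hA
  have hb : (∫ s in Ioi (0 : ℝ), Real.exp (-t ^ 2 / (4 * s)) * heatKernel lam s x y /
      s ^ (3 / 2 : ℝ)) * y ^ (2 * lam) ≤ C * (4 / (t ^ 2 + (y - x) ^ 2)) := by
    have he' : ∫ s in Ioi (0 : ℝ), C * (s ^ (-1 - 1 : ℝ) *
        Real.exp (-(t ^ 2 + (y - x) ^ 2) / (4 * s))) = C * (4 / (t ^ 2 + (y - x) ^ 2)) := by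
      rw [integral_const_mul, he]; simp
    rw [← he', ← integral_mul_const]
    refine integral_mono_of_nonneg ?_ (hi.const_mul C) ?_
    · filter_upwards [ae_restrict_mem measurableSet_Ioi] with s hs
      have hs : 0 < s := hs
      have := hm.heatKernel_nonneg hlam hs hx hy
      simp only [Pi.zero_apply]
      positivity
    · filter_upwards [ae_restrict_mem measurableSet_Ioi] with s hs
      have hs : 0 < s := hs
      have h := hle s x y hs hx hy hyx
      have e1 : s ^ (-1 - 1 : ℝ) = s ^ (-(1 / 2) : ℝ) / s ^ (3 / 2 : ℝ) := by
        rw [← Real.rpow_sub hs]; congr 1; norm_num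
      have e2 : Real.exp (-(t ^ 2 + (y - x) ^ 2) / (4 * s)) =
          Real.exp (-t ^ 2 / (4 * s)) * Real.exp (-(y - x) ^ 2 / (4 * s)) := by
        rw [← Real.exp_add]; congr 1; ring
      rw [e1, e2]
      calc _ = Real.exp (-t ^ 2 / (4 * s)) / s ^ (3 / 2 : ℝ) *
            (heatKernel lam s x y * y ^ (2 * lam)) := by ring
        _ ≤ Real.exp (-t ^ 2 / (4 * s)) / s ^ (3 / 2 : ℝ) *
            (C * (s ^ (-(1 / 2) : ℝ) * Real.exp (-(y - x) ^ 2 / (4 * s)))) := by gcongr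
        _ = _ := by ring
  rw [poissonKernel]
  calc _ = t / √(4 * Real.pi) * ((∫ s in Ioi (0 : ℝ), Real.exp (-t ^ 2 / (4 * s)) *
        heatKernel lam s x y / s ^ (3 / 2 : ℝ)) * y ^ (2 * lam)) := by ring
    _ ≤ t / √(4 * Real.pi) * (C * (4 / (t ^ 2 + (y - x) ^ 2))) := by gcongr
    _ = _ := by ring

/-- The Poisson semigroup is conservative. -/
theorem integral_poissonKernel (hm : IsAngularMeasure lam m) (hlam : 0 ≤ lam) {t x : ℝ}
    (ht : 0 < t) (hx : 0 < x) :
    IntegrableOn (fun y => poissonKernel lam t x y * y ^ (2 * lam)) (Ioi 0) ∧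
      ∫ y in Ioi (0 : ℝ), poissonKernel lam t x y * y ^ (2 * lam) = 1 := by
  have := hm.prob
  set k : ℝ → ℝ := fun s => t / √(4 * Real.pi) * (s ^ (-(1 / 2) - 1 : ℝ) *
    Real.exp (-t ^ 2 / (4 * s))) with hk
  obtain ⟨hi, he⟩ := integral_rpow_mul_exp_neg_div (a := 1 / 2) (A := t ^ 2) (by norm_num)
    (by positivity)
  have hki : IntegrableOn k (Ioi 0) := hi.const_mul _
  have hk1 : ∫ s in Ioi (0 : ℝ), k s = 1 := by
    simp only [hk]
    rw [integral_const_mul, he, Real.Gamma_one_half_eq, ← Real.sqrt_eq_rpow,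
      Real.sqrt_div' _ (by positivity), Real.sqrt_sq ht.le, Real.sqrt_mul (by norm_num)]
    have : 0 < √Real.pi := Real.sqrt_pos.2 Real.pi_pos
    have : 0 < √(4 : ℝ) := by positivity
    field_simp
  have hk0 : ∀ s, 0 < s → 0 ≤ k s := fun s hs => by simp only [hk]; positivity
  set H : ℝ → ℝ → ℝ := fun s y => k s * (heatKernel lam s x y * y ^ (2 * lam)) with hH
  have hHm : AEStronglyMeasurable (Function.uncurry H)
      ((volume.restrict (Ioi (0 : ℝ))).prod (volume.restrict (Ioi (0 : ℝ)))) := by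
    have h1 : StronglyMeasurable fun w : ℝ × ℝ => ∫ r,
        Real.exp (-(x ^ 2 + w.2 ^ 2 - 2 * x * w.2 * r) / (4 * w.1)) ∂m :=
      StronglyMeasurable.integral_prod_right'
        (f := fun w : (ℝ × ℝ) × ℝ =>
          Real.exp (-(x ^ 2 + w.1.2 ^ 2 - 2 * x * w.1.2 * w.2) / (4 * w.1.1)))
        (Measurable.stronglyMeasurable (by fun_prop))
    have h2 : Measurable fun w : ℝ × ℝ => k w.1 * (heatConst lam * w.1 ^ (-lam - 1 / 2) *
        (∫ r, Real.exp (-(x ^ 2 + w.2 ^ 2 - 2 * x * w.2 * r) / (4 * w.1)) ∂m)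
          * w.2 ^ (2 * lam)) := by
      have := h1.measurable
      simp only [hk]
      fun_prop
    refine h2.aestronglyMeasurable.congr ?_
    filter_upwards [Measure.quasiMeasurePreserving_fst.ae (ae_restrict_mem measurableSet_Ioi),
      Measure.quasiMeasurePreserving_snd.ae (ae_restrict_mem measurableSet_Ioi)] with w hw1 hw2
    simp only [Function.uncurry, hH]
    rw [hm.heatKernel_eq hlam hw1 hx hw2]
  have hHi : Integrable (Function.uncurry H)
      ((volume.restrict (Ioi (0 : ℝ))).prod (volume.restrict (Ioi (0 : ℝ)))) := by
    rw [integrable_prod_iff hHm]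
    constructor
    · filter_upwards [ae_restrict_mem measurableSet_Ioi] with s hs
      exact (hm.integral_heatKernel hlam hs hx).1.const_mul (k s)
    · refine hki.congr ?_
      filter_upwards [ae_restrict_mem measurableSet_Ioi] with s hs
      have hs : 0 < s := hs
      have : ∫ y in Ioi (0 : ℝ), ‖Function.uncurry H (s, y)‖ =
          ∫ y in Ioi (0 : ℝ), k s * (heatKernel lam s x y * y ^ (2 * lam)) := by
        refine setIntegral_congr_fun measurableSet_Ioi fun y hy => ?_
        have hy : 0 < y := hy
        have := hm.heatKernel_nonneg hlam hs hx hy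
        have := hk0 s hs
        simp only [Function.uncurry, hH]
        exact Real.norm_of_nonneg (by positivity)
      rw [this, integral_const_mul, (hm.integral_heatKernel hlam hs hx).2, mul_one]
  have hP : EqOn (fun y => ∫ s in Ioi (0 : ℝ), H s y)
      (fun y => poissonKernel lam t x y * y ^ (2 * lam)) (Ioi 0) := by
    intro y hy
    simp only [poissonKernel]
    rw [mul_assoc, ← integral_mul_const, ← integral_const_mul]
    refine setIntegral_congr_fun measurableSet_Ioi fun s hs => ?_
    have hs : 0 < s := hs
    simp only [hH, hk]
    rw [show (-(1 / 2) - 1 : ℝ) = -(3 / 2) by norm_num, Real.rpow_neg hs.le]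
    ring
  constructor
  · exact IntegrableOn.congr_fun (s := Ioi 0) hHi.integral_prod_right hP measurableSet_Ioi
  · rw [← setIntegral_congr_fun measurableSet_Ioi hP, ← integral_integral_swap hHi, ← hk1]
    refine setIntegral_congr_fun measurableSet_Ioi fun s hs => ?_
    simp only [hH]
    rw [integral_const_mul, (hm.integral_heatKernel hlam hs hx).2, mul_one]

end IsAngularMeasure

theorem hasDerivAt_comp_pair {G : ℝ × ℝ → ℝ} {a b : ℝ → ℝ} {g₁ g₂ a' b' t : ℝ}
    (hG : HasFDerivAt G (g₁ • ContinuousLinearMap.fst ℝ ℝ ℝ + g₂ • ContinuousLinearMap.snd ℝ ℝ ℝ)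
      (a t, b t)) (ha : HasDerivAt a a' t) (hb : HasDerivAt b b' t) :
    HasDerivAt (fun t => G (a t, b t)) (g₁ * a' + g₂ * b') t := by
  have h := hG.comp_hasDerivAt t (ha.prodMk hb)
  exact h.congr_deriv (by simp)

theorem integrableOn_Icc_of_integrableOn_mul {φ f : ℝ → ℝ} (hφ : ContinuousOn φ (Ioi 0))
    (hpos : ∀ y, 0 < y → 0 < φ y) (hi : IntegrableOn (fun y => φ y * f y) (Ioi 0)) {a b : ℝ}
    (ha : 0 < a) : IntegrableOn f (Icc a b) := by
  have hsub : Icc a b ⊆ Ioi 0 := fun y hy => ha.trans_le hy.1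
  have h := (hi.mono_set hsub).continuousOn_mul
    ((hφ.mono hsub).inv₀ fun y hy => (hpos y (hsub hy)).ne') isCompact_Icc
  refine h.congr_fun (fun y hy => ?_) measurableSet_Icc
  have := (hpos y (hsub hy)).ne'
  simp only [Pi.inv_apply]
  field_simp

theorem exists_mem_timeInterval {T : EReal} (hT : 0 < T) : ∃ t, t ∈ timeInterval T := by
  obtain ⟨r, hr0, hr⟩ := EReal.lt_iff_exists_real_btwn.1 hT
  exact ⟨r, by exact_mod_cast hr0, hr⟩

theorem exists_gt_mem_timeInterval {T : EReal} {t : ℝ} (ht : t ∈ timeInterval T) :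
    ∃ t' ∈ timeInterval T, t < t' := by
  obtain ⟨r, hr0, hr⟩ := EReal.lt_iff_exists_real_btwn.1 ht.2
  have : t < r := by exact_mod_cast hr0
  exact ⟨r, ⟨ht.1.trans this, hr⟩, this⟩

theorem mem_timeInterval_of_le {T : EReal} {s t : ℝ} (ht : t ∈ timeInterval T) (hs : 0 < s)
    (hst : s ≤ t) : s ∈ timeInterval T :=
  ⟨hs, lt_of_le_of_lt (by exact_mod_cast hst) ht.2⟩

theorem isOpen_timeInterval (T : EReal) : IsOpen (timeInterval T) :=
  isOpen_Ioi.inter (isOpen_Iio.preimage continuous_coe_real_ereal)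

theorem eventually_mem_timeInterval {T : EReal} (hT : 0 < T) :
    ∀ᶠ t in 𝓝[>] (0 : ℝ), t ∈ timeInterval T := by
  obtain ⟨t, ht⟩ := exists_mem_timeInterval hT
  filter_upwards [Ioc_mem_nhdsGT ht.1] with s hs using mem_timeInterval_of_le ht hs.1 hs.2

section HeatFactor

variable {lam : ℝ}

theorem heatFactor_eq {t y : ℝ} (hy : 0 < y) :
    heatFactor lam t y = y ^ (2 * lam) * (1 + y) ^ (-lam) * Real.exp (-y ^ 2 / (4 * t)) := by
  rw [heatFactor, Real.div_rpow hy.le (by positivity), two_mul, Real.rpow_add hy,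
    Real.rpow_neg (by positivity), add_comm 1 y]
  ring

theorem heatFactor_pos {t y : ℝ} (hy : 0 < y) : 0 < heatFactor lam t y := by
  rw [heatFactor_eq hy]; positivity

theorem continuousOn_heatFactor (t : ℝ) : ContinuousOn (heatFactor lam t) (Ioi 0) := by
  unfold heatFactor
  have h1 : ContinuousOn (fun y : ℝ => y / (y + 1)) (Ioi 0) :=
    continuousOn_id.div (by fun_prop) fun y hy => by
      have hy : 0 < y := hy
      positivity
  refine ((continuousOn_id.rpow_const fun y hy => Or.inl (ne_of_gt hy)).mul
    (h1.rpow_const fun y hy => Or.inl ?_)).mul (by fun_prop)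
  have hy : 0 < y := hy
  positivity

theorem exists_gaussian_le_heatFactor (hlam : 0 ≤ lam) {t a : ℝ} (ha : 1 / (4 * t) < a)
    (B : ℝ) (n : ℕ) : ∃ C, 0 ≤ C ∧ ∀ y, 0 < y →
      y ^ n * Real.exp (-a * y ^ 2 + B * y) * y ^ (2 * lam) ≤ C * heatFactor lam t y := by
  set ε := a - 1 / (4 * t) with hε
  have hε0 : 0 < ε := by simp only [hε]; linarith
  refine ⟨Real.exp ((n + lam + B) ^ 2 / (4 * ε)), (Real.exp_pos _).le, fun y hy => ?_⟩
  rw [heatFactor_eq hy]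
  have h1 : y ^ n ≤ Real.exp (n * y) := by
    rw [Real.exp_nat_mul]
    have := Real.add_one_le_exp y
    gcongr
    linarith
  have h2 : 1 ≤ Real.exp (lam * y) * (1 + y) ^ (-lam) := by
    rw [Real.rpow_neg (by positivity), ← div_eq_mul_inv, one_le_div (by positivity), mul_comm,
      Real.exp_mul]
    refine Real.rpow_le_rpow (by positivity) ?_ hlam
    linarith [Real.add_one_le_exp y]
  have h3 : Real.exp (n * y) * Real.exp (lam * y) * Real.exp (-a * y ^ 2 + B * y) ≤
      Real.exp ((n + lam + B) ^ 2 / (4 * ε)) * Real.exp (-y ^ 2 / (4 * t)) := by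
    rw [← Real.exp_add, ← Real.exp_add, ← Real.exp_add]
    refine Real.exp_le_exp.2 ?_
    have h4 : (n + lam + B) * y - ε * y ^ 2 ≤ (n + lam + B) ^ 2 / (4 * ε) := by
      rw [le_div_iff₀ (by positivity)]
      nlinarith [sq_nonneg (2 * ε * y - (n + lam + B))]
    have h5 : a = ε + 1 / (4 * t) := by simp only [hε]; ring
    rw [h5]
    have h6 : -y ^ 2 / (4 * t) = -(1 / (4 * t)) * y ^ 2 := by ring
    rw [h6]
    linarith
  calc y ^ n * Real.exp (-a * y ^ 2 + B * y) * y ^ (2 * lam)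
      ≤ Real.exp (n * y) * Real.exp (-a * y ^ 2 + B * y) * y ^ (2 * lam) := by gcongr
    _ ≤ Real.exp (n * y) * Real.exp (-a * y ^ 2 + B * y) * y ^ (2 * lam) *
        (Real.exp (lam * y) * (1 + y) ^ (-lam)) := le_mul_of_one_le_right (by positivity) h2
    _ = Real.exp (n * y) * Real.exp (lam * y) * Real.exp (-a * y ^ 2 + B * y) *
        (y ^ (2 * lam) * (1 + y) ^ (-lam)) := by ring
    _ ≤ Real.exp ((n + lam + B) ^ 2 / (4 * ε)) * Real.exp (-y ^ 2 / (4 * t)) *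
        (y ^ (2 * lam) * (1 + y) ^ (-lam)) := by gcongr
    _ = _ := by ring

end HeatFactor

/-- The integrand of the `(j, k)`-th partial derivative of the Laplace transform
`(a, b) ↦ ∫∫ exp (-a y² + b s y) f(y) y^{2λ} dm(s) dy`. -/
noncomputable def heatIntegrand (lam : ℝ) (f : ℝ → ℝ) (j k : ℕ) (q w : ℝ × ℝ) : ℝ :=
  (-w.1 ^ 2) ^ j * (w.2 * w.1) ^ k * Real.exp (-q.1 * w.1 ^ 2 + q.2 * (w.2 * w.1)) *
    (f w.1 * w.1 ^ (2 * lam))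

/-- The partial derivatives of the Laplace transform representing the heat extension. -/
noncomputable def heatTransform (lam : ℝ) (m : Measure ℝ) (f : ℝ → ℝ) (j k : ℕ) (q : ℝ × ℝ) : ℝ :=
  ∫ w, heatIntegrand lam f j k q w ∂((volume.restrict (Ioi (0 : ℝ))).prod m)

/-- The domain of convergence of the Laplace transform. -/
def heatDomain (T : EReal) : Set (ℝ × ℝ) := {q | ∃ t ∈ timeInterval T, 1 / (4 * t) < q.1}

theorem isOpen_heatDomain (T : EReal) : IsOpen (heatDomain T) := by
  have : heatDomain T = ⋃ t ∈ timeInterval T, {q : ℝ × ℝ | 1 / (4 * t) < q.1} := by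
    ext q; simp [heatDomain]
  rw [this]
  exact isOpen_biUnion fun t _ => isOpen_lt continuous_const continuous_fst

theorem mem_heatDomain {T : EReal} {t : ℝ} (ht : t ∈ timeInterval T) (b : ℝ) :
    (1 / (4 * t), b) ∈ heatDomain T := by
  obtain ⟨t', ht', h⟩ := exists_gt_mem_timeInterval ht
  refine ⟨t', ht', ?_⟩
  have := ht.1
  exact one_div_lt_one_div_of_lt (by positivity) (by linarith)

theorem hasFDerivAt_heatIntegrand (lam : ℝ) (f : ℝ → ℝ) (j k : ℕ) (q w : ℝ × ℝ) :
    HasFDerivAt (fun q => heatIntegrand lam f j k q w)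
      (heatIntegrand lam f (j + 1) k q w • ContinuousLinearMap.fst ℝ ℝ ℝ
        + heatIntegrand lam f j (k + 1) q w • ContinuousLinearMap.snd ℝ ℝ ℝ) q := by
  have h1 : HasFDerivAt (fun q : ℝ × ℝ => -q.1 * w.1 ^ 2 + q.2 * (w.2 * w.1))
      ((-w.1 ^ 2) • ContinuousLinearMap.fst ℝ ℝ ℝ + (w.2 * w.1) • ContinuousLinearMap.snd ℝ ℝ ℝ)
      q := by
    have h := (hasFDerivAt_fst (𝕜 := ℝ) (E := ℝ) (F := ℝ) (p := q)).const_mul (-w.1 ^ 2)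
    have h' := (hasFDerivAt_snd (𝕜 := ℝ) (E := ℝ) (F := ℝ) (p := q)).const_mul (w.2 * w.1)
    refine (h.add h').congr_of_eventuallyEq (Eventually.of_forall fun q => ?_)
    simp only [Pi.add_apply]
    ring
  have h2 := ((h1.exp).const_mul ((-w.1 ^ 2) ^ j * (w.2 * w.1) ^ k)).mul_const
    (f w.1 * w.1 ^ (2 * lam))
  refine h2.congr_fderiv ?_
  ext <;> simp [heatIntegrand] <;> ring

section HeatTransform

variable {lam : ℝ} {m : Measure ℝ} {T : EReal} {f : ℝ → ℝ}

theorem aestronglyMeasurable_heatIntegrand [IsProbabilityMeasure m]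
    (hf : AEStronglyMeasurable f (volume.restrict (Ioi (0 : ℝ)))) (j k : ℕ) (q : ℝ × ℝ) :
    AEStronglyMeasurable (heatIntegrand lam f j k q)
      ((volume.restrict (Ioi (0 : ℝ))).prod m) := by
  unfold heatIntegrand
  refine AEStronglyMeasurable.mul (Measurable.aestronglyMeasurable (by fun_prop))
    (hf.comp_fst.mul (Measurable.aestronglyMeasurable (by fun_prop)))

theorem heatIntegrand_dominated (hm : IsAngularMeasure lam m) (hlam : 0 ≤ lam)
    (hfi : ∀ t ∈ timeInterval T, IntegrableOn (fun y => heatFactor lam t y * f y) (Ioi 0))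
    (j k : ℕ) {q : ℝ × ℝ} (hq : q ∈ heatDomain T) :
    ∃ V ∈ 𝓝 q, ∃ bound : ℝ × ℝ → ℝ,
      Integrable bound ((volume.restrict (Ioi (0 : ℝ))).prod m) ∧
      ∀ᵐ w ∂((volume.restrict (Ioi (0 : ℝ))).prod m), ∀ q' ∈ V,
        |heatIntegrand lam f j k q' w| ≤ bound w := by
  have := hm.prob
  obtain ⟨t, ht, hlt⟩ := hq
  obtain ⟨a, ha1, ha2⟩ := exists_between hlt
  obtain ⟨C, hC, hle⟩ := exists_gaussian_le_heatFactor hlam ha1 (|q.2| + 1) (2 * j + k)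
  refine ⟨{q' | a < q'.1 ∧ |q'.2| < |q.2| + 1}, ?_,
    fun w => C * |heatFactor lam t w.1 * f w.1|, ?_, ?_⟩
  · exact ((isOpen_lt continuous_const continuous_fst).inter
      (isOpen_lt (continuous_abs.comp continuous_snd) continuous_const)).mem_nhds
      ⟨ha2, show |q.2| < |q.2| + 1 from lt_add_one _⟩
  · have h := ((hfi t ht).abs.const_mul C).comp_fst m
    exact h
  · filter_upwards [hm.ae_prod_mem] with w hw q' hq'
    obtain ⟨hw1, hw2⟩ := hw
    have hs : |w.2| ≤ 1 := abs_le.2 hw2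
    simp only [heatIntegrand]
    have e1 : |(-w.1 ^ 2) ^ j * (w.2 * w.1) ^ k| ≤ w.1 ^ (2 * j + k) := by
      rw [abs_mul, abs_pow, abs_pow, abs_neg, abs_pow, abs_mul, abs_of_pos hw1, pow_add, pow_mul]
      gcongr
      exact mul_le_of_le_one_left hw1.le hs
    have e2 : Real.exp (-q'.1 * w.1 ^ 2 + q'.2 * (w.2 * w.1)) ≤
        Real.exp (-a * w.1 ^ 2 + (|q.2| + 1) * w.1) := by
      refine Real.exp_le_exp.2 (add_le_add ?_ ?_)
      · have := hq'.1
        gcongr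
      · calc q'.2 * (w.2 * w.1) ≤ |q'.2 * (w.2 * w.1)| := le_abs_self _
          _ = |q'.2| * (|w.2| * w.1) := by rw [abs_mul, abs_mul, abs_of_pos hw1]
          _ ≤ (|q.2| + 1) * (1 * w.1) := by
            have := hq'.2.le
            gcongr
          _ = _ := by ring
    rw [abs_mul, abs_mul, abs_mul (f w.1), abs_of_pos (Real.exp_pos _),
      abs_of_pos (Real.rpow_pos_of_pos hw1 _), abs_mul (heatFactor lam t w.1),
      abs_of_pos (heatFactor_pos hw1)]
    calc _ ≤ w.1 ^ (2 * j + k) * Real.exp (-a * w.1 ^ 2 + (|q.2| + 1) * w.1) *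
          (|f w.1| * w.1 ^ (2 * lam)) := by gcongr
      _ = w.1 ^ (2 * j + k) * Real.exp (-a * w.1 ^ 2 + (|q.2| + 1) * w.1) * w.1 ^ (2 * lam) *
          |f w.1| := by ring
      _ ≤ C * heatFactor lam t w.1 * |f w.1| :=
          mul_le_mul_of_nonneg_right (hle _ hw1) (abs_nonneg _)
      _ = _ := by ring

theorem integrable_heatIntegrand (hm : IsAngularMeasure lam m) (hlam : 0 ≤ lam)
    (hf : AEStronglyMeasurable f (volume.restrict (Ioi (0 : ℝ))))
    (hfi : ∀ t ∈ timeInterval T, IntegrableOn (fun y => heatFactor lam t y * f y) (Ioi 0))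
    (j k : ℕ) {q : ℝ × ℝ} (hq : q ∈ heatDomain T) :
    Integrable (heatIntegrand lam f j k q) ((volume.restrict (Ioi (0 : ℝ))).prod m) := by
  have := hm.prob
  obtain ⟨V, hV, b, hb, hle⟩ := heatIntegrand_dominated hm hlam hfi j k hq
  refine hb.mono' (aestronglyMeasurable_heatIntegrand hf j k q) ?_
  filter_upwards [hle] with w h using h q (mem_of_mem_nhds hV)

theorem hasFDerivAt_heatTransform (hm : IsAngularMeasure lam m) (hlam : 0 ≤ lam)
    (hf : AEStronglyMeasurable f (volume.restrict (Ioi (0 : ℝ))))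
    (hfi : ∀ t ∈ timeInterval T, IntegrableOn (fun y => heatFactor lam t y * f y) (Ioi 0))
    (j k : ℕ) {q : ℝ × ℝ} (hq : q ∈ heatDomain T) :
    HasFDerivAt (heatTransform lam m f j k)
      (heatTransform lam m f (j + 1) k q • ContinuousLinearMap.fst ℝ ℝ ℝ
        + heatTransform lam m f j (k + 1) q • ContinuousLinearMap.snd ℝ ℝ ℝ) q := by
  have := hm.prob
  exact hasFDerivAt_integral_of_family (isOpen_heatDomain T) (F := heatIntegrand lam f)
    (fun j k q _ => aestronglyMeasurable_heatIntegrand hf j k q)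
    (fun j k => Eventually.of_forall fun w q _ => hasFDerivAt_heatIntegrand lam f j k q w)
    (fun j k q hq => heatIntegrand_dominated hm hlam hfi j k hq) j k hq

/-- The equation satisfied by the Laplace transform. -/
theorem heatTransform_equation (hm : IsAngularMeasure lam m) (hlam : 0 ≤ lam)
    (hf : AEStronglyMeasurable f (volume.restrict (Ioi (0 : ℝ))))
    (hfi : ∀ t ∈ timeInterval T, IntegrableOn (fun y => heatFactor lam t y * f y) (Ioi 0))
    {q : ℝ × ℝ} (hq : q ∈ heatDomain T) :
    q.2 * heatTransform lam m f 0 2 q + 2 * lam * heatTransform lam m f 0 1 q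
      + q.2 * heatTransform lam m f 1 0 q = 0 := by
  have := hm.prob
  have hi := fun j k => integrable_heatIntegrand hm hlam hf hfi j k hq
  have hi₂ : Integrable (fun w => q.2 * heatIntegrand lam f 0 2 q w
      + 2 * lam * heatIntegrand lam f 0 1 q w) ((volume.restrict (Ioi (0 : ℝ))).prod m) :=
    ((hi 0 2).const_mul _).add ((hi 0 1).const_mul _)
  have hi₃ : Integrable (fun w => q.2 * heatIntegrand lam f 0 2 q w
      + 2 * lam * heatIntegrand lam f 0 1 q w + q.2 * heatIntegrand lam f 1 0 q w)
      ((volume.restrict (Ioi (0 : ℝ))).prod m) := hi₂.add ((hi 1 0).const_mul _)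
  simp only [heatTransform]
  rw [← integral_const_mul, ← integral_const_mul, ← integral_const_mul,
    ← integral_add ((hi 0 2).const_mul _) ((hi 0 1).const_mul _),
    ← integral_add hi₂ ((hi 1 0).const_mul _), integral_prod _ hi₃]
  refine integral_eq_zero_of_ae (Eventually.of_forall fun y => ?_)
  have h := hm.ibp (fun s => Real.exp (q.2 * (s * y)))
    (fun s => Real.exp (q.2 * (s * y)) * (q.2 * y))
    (fun s _ => by
      have h1 : HasDerivAt (fun s : ℝ => q.2 * (s * y)) (q.2 * y) s := by
        simpa using ((hasDerivAt_id s).mul_const y).const_mul q.2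
      exact h1.exp) (by fun_prop)
  have e : ∀ s : ℝ, q.2 * heatIntegrand lam f 0 2 q (y, s)
      + 2 * lam * heatIntegrand lam f 0 1 q (y, s) + q.2 * heatIntegrand lam f 1 0 q (y, s) =
      (Real.exp (-q.1 * y ^ 2) * (f y * y ^ (2 * lam)) * y) *
        (2 * lam * (s * Real.exp (q.2 * (s * y)))
          - (1 - s ^ 2) * (Real.exp (q.2 * (s * y)) * (q.2 * y))) := by
    intro s
    simp only [heatIntegrand, Real.exp_add]
    ring
  simp only [e, Pi.zero_apply]
  rw [integral_const_mul, integral_sub ((hm.integrable (by fun_prop)).const_mul _)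
    (hm.integrable (by fun_prop)), integral_const_mul, h, sub_self, mul_zero]

theorem heatExtension_eq (hm : IsAngularMeasure lam m) (hlam : 0 ≤ lam)
    (hf : AEStronglyMeasurable f (volume.restrict (Ioi (0 : ℝ))))
    (hfi : ∀ t ∈ timeInterval T, IntegrableOn (fun y => heatFactor lam t y * f y) (Ioi 0))
    {t x : ℝ} (ht : t ∈ timeInterval T) (hx : 0 < x) :
    IntegrableOn (fun y => heatKernel lam t x y * f y * y ^ (2 * lam)) (Ioi 0) ∧
    kernelIntegral lam (heatKernel lam) f t x = heatConst lam *
      (t ^ (-lam - 1 / 2) * Real.exp (-x ^ 2 / (4 * t)) *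
        heatTransform lam m f 0 0 (1 / (4 * t), x / (2 * t))) := by
  have := hm.prob
  have ht0 := ht.1
  have hi := integrable_heatIntegrand hm hlam hf hfi 0 0 (mem_heatDomain ht (x / (2 * t)))
  have he : EqOn (fun y => heatConst lam * (t ^ (-lam - 1 / 2) * Real.exp (-x ^ 2 / (4 * t))) *
      ∫ s, heatIntegrand lam f 0 0 (1 / (4 * t), x / (2 * t)) (y, s) ∂m)
      (fun y => heatKernel lam t x y * f y * y ^ (2 * lam)) (Ioi 0) := by
    intro y hy
    simp only [heatIntegrand]
    rw [hm.heatKernel_eq_exp_mul hlam ht0 hx hy]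
    have e1 : ∀ s : ℝ, (-y ^ 2) ^ 0 * (s * y) ^ 0 *
        Real.exp (-(1 / (4 * t)) * y ^ 2 + x / (2 * t) * (s * y)) * (f y * y ^ (2 * lam)) =
        Real.exp (-y ^ 2 / (4 * t)) * (f y * y ^ (2 * lam)) *
          Real.exp (x * y / (2 * t) * s) := by
      intro s
      rw [Real.exp_add, show -(1 / (4 * t)) * y ^ 2 = -y ^ 2 / (4 * t) by ring,
        show x / (2 * t) * (s * y) = x * y / (2 * t) * s by ring]
      ring
    simp_rw [e1]
    rw [integral_const_mul, show -(x ^ 2 + y ^ 2) / (4 * t) =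
      -x ^ 2 / (4 * t) + -y ^ 2 / (4 * t) by ring, Real.exp_add]
    ring
  constructor
  · exact IntegrableOn.congr_fun (s := Ioi 0) (hi.integral_prod_left.const_mul _) he
      measurableSet_Ioi
  · rw [kernelIntegral, ← setIntegral_congr_fun measurableSet_Ioi he, integral_const_mul,
      heatTransform, integral_prod _ hi]
    ring

theorem smoothOn_heatExtension (hm : IsAngularMeasure lam m) (hlam : 0 ≤ lam)
    (hf : AEStronglyMeasurable f (volume.restrict (Ioi (0 : ℝ))))
    (hfi : ∀ t ∈ timeInterval T, IntegrableOn (fun y => heatFactor lam t y * f y) (Ioi 0)) :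
    SmoothOn T (kernelIntegral lam (heatKernel lam) f) := by
  have hG := contDiffOn_of_family (isOpen_heatDomain T) (G := heatTransform lam m f)
    (fun j k q hq => hasFDerivAt_heatTransform hm hlam hf hfi j k hq) 0 0
  have hne : ∀ q ∈ timeInterval T ×ˢ Ioi (0 : ℝ), q.1 ≠ 0 := fun q hq => hq.1.1.ne'
  have hmap : ContDiffOn ℝ ∞ (fun q : ℝ × ℝ => (1 / (4 * q.1), q.2 / (2 * q.1)))
      (timeInterval T ×ˢ Ioi (0 : ℝ)) := by
    refine ContDiffOn.prodMk (contDiffOn_const.div (by fun_prop) ?_)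
      (contDiffOn_snd.div (by fun_prop) ?_)
    all_goals
      intro q hq
      have := hne q hq
      positivity
  have hcomp := hG.comp hmap fun q hq => mem_heatDomain hq.1 _
  refine ContDiffOn.congr (f := fun q : ℝ × ℝ => heatConst lam *
      (q.1 ^ (-lam - 1 / 2) * Real.exp (-q.2 ^ 2 / (4 * q.1)) *
        heatTransform lam m f 0 0 (1 / (4 * q.1), q.2 / (2 * q.1)))) ?_
    fun q hq => (heatExtension_eq hm hlam hf hfi hq.1 hq.2).2
  refine contDiffOn_const.mul (ContDiffOn.mul (ContDiffOn.mul ?_ ?_) hcomp)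
  · exact contDiffOn_fst.rpow_const_of_ne hne
  · refine ContDiffOn.exp (ContDiffOn.div (by fun_prop) (by fun_prop) ?_)
    intro q hq
    have := hne q hq
    positivity

theorem heatEq_heatExtension (hm : IsAngularMeasure lam m) (hlam : 0 ≤ lam)
    (hf : AEStronglyMeasurable f (volume.restrict (Ioi (0 : ℝ))))
    (hfi : ∀ t ∈ timeInterval T, IntegrableOn (fun y => heatFactor lam t y * f y) (Ioi 0)) :
    HeatEq lam T (kernelIntegral lam (heatKernel lam) f) := by
  intro t ht x hx
  have ht0 := ht.1
  set c := heatConst lam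
  set G := heatTransform lam m f with hGdef
  have hG : ∀ j k, ∀ q ∈ heatDomain T, HasFDerivAt (G j k)
      (G (j + 1) k q • ContinuousLinearMap.fst ℝ ℝ ℝ
        + G j (k + 1) q • ContinuousLinearMap.snd ℝ ℝ ℝ) q :=
    fun j k q hq => hasFDerivAt_heatTransform hm hlam hf hfi j k hq
  set p := t ^ (-lam - 1 / 2)
  set e := Real.exp (-x ^ 2 / (4 * t))
  set q : ℝ × ℝ := (1 / (4 * t), x / (2 * t)) with hq
  have hdt : HasDerivAt (fun s => kernelIntegral lam (heatKernel lam) f s x)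
      (c * (p * e) * (((-lam - 1 / 2) / t + x ^ 2 / (4 * t ^ 2)) * G 0 0 q
        - G 1 0 q / (4 * t ^ 2) - x / (2 * t ^ 2) * G 0 1 q)) t := by
    have h1 : HasDerivAt (fun s : ℝ => s ^ (-lam - 1 / 2)) ((-lam - 1 / 2) / t * p) t := by
      refine (Real.hasDerivAt_rpow_const (p := -lam - 1 / 2) (Or.inl ht0.ne')).congr_deriv ?_
      rw [Real.rpow_sub_one ht0.ne']; ring
    have ha : HasDerivAt (fun s : ℝ => 1 / (4 * s)) (-1 / (4 * t ^ 2)) t := by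
      have := ((hasDerivAt_id t).const_mul (4 : ℝ)).inv (by simpa using ht0.ne')
      refine (this.congr_deriv ?_).congr_of_eventuallyEq (Eventually.of_forall fun s => ?_)
      · simp only [id]; field_simp
      · simp
    have hb : HasDerivAt (fun s : ℝ => x / (2 * s)) (-x / (2 * t ^ 2)) t := by
      refine ((ha.const_mul (2 * x)).congr_deriv ?_).congr_of_eventuallyEq
        (Eventually.of_forall fun s => ?_)
      · field_simp; norm_num
      · simp only; field_simp; ring
    have h2 : HasDerivAt (fun s : ℝ => Real.exp (-x ^ 2 / (4 * s)))
        (e * (x ^ 2 / (4 * t ^ 2))) t := by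
      have : HasDerivAt (fun s : ℝ => -x ^ 2 / (4 * s)) (x ^ 2 / (4 * t ^ 2)) t := by
        refine ((ha.const_mul (-x ^ 2)).congr_deriv ?_).congr_of_eventuallyEq
          (Eventually.of_forall fun s => ?_)
        · ring
        · simp only; ring
      exact this.exp
    have h3 := hasDerivAt_comp_pair (G := G 0 0) (hG 0 0 q (mem_heatDomain ht _)) ha hb
    have h12 : HasDerivAt (fun s : ℝ => s ^ (-lam - 1 / 2) * Real.exp (-x ^ 2 / (4 * s)))
        ((-lam - 1 / 2) / t * p * e + p * (e * (x ^ 2 / (4 * t ^ 2)))) t := h1.mul h2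
    have h123 : HasDerivAt (fun s : ℝ => s ^ (-lam - 1 / 2) * Real.exp (-x ^ 2 / (4 * s)) *
        G 0 0 (1 / (4 * s), x / (2 * s)))
        (((-lam - 1 / 2) / t * p * e + p * (e * (x ^ 2 / (4 * t ^ 2)))) * G 0 0 q +
          p * e * (G 1 0 q * (-1 / (4 * t ^ 2)) + G 0 1 q * (-x / (2 * t ^ 2)))) t := h12.mul h3
    refine ((h123.const_mul c).congr_deriv ?_).congr_of_eventuallyEq ?_
    · ring
    · filter_upwards [(isOpen_timeInterval T).mem_nhds ht] with s hs
      exact (heatExtension_eq hm hlam hf hfi hs hx).2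
  have hder : ∀ k z, HasDerivAt (fun z => G 0 k (1 / (4 * t), z / (2 * t)))
      (G 0 (k + 1) (1 / (4 * t), z / (2 * t)) / (2 * t)) z := by
    intro k z
    have h := hasDerivAt_comp_pair (G := G 0 k) (a := fun _ => 1 / (4 * t))
      (b := fun z => z / (2 * t)) (hG 0 k _ (mem_heatDomain ht (z / (2 * t))))
      (hasDerivAt_const z _) ((hasDerivAt_id z).div_const (2 * t))
    refine h.congr_deriv ?_
    ring
  have hexp : ∀ z, HasDerivAt (fun z => Real.exp (-z ^ 2 / (4 * t)))
      (Real.exp (-z ^ 2 / (4 * t)) * (-z / (2 * t))) z := by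
    intro z
    have : HasDerivAt (fun z : ℝ => -z ^ 2 / (4 * t)) (-z / (2 * t)) z := by
      refine ((hasDerivAt_pow 2 z).neg.div_const (4 * t)).congr_deriv ?_
      field_simp; norm_num; ring
    exact this.exp
  have hdx : ∀ z, 0 < z → HasDerivAt (kernelIntegral lam (heatKernel lam) f t)
      (c * (p * Real.exp (-z ^ 2 / (4 * t)) * (-(z / (2 * t)) * G 0 0 (1 / (4 * t), z / (2 * t))
        + G 0 1 (1 / (4 * t), z / (2 * t)) / (2 * t)))) z := by
    intro z hz
    refine ((((hexp z).const_mul p).mul (hder 0 z)).const_mul c |>.congr_deriv ?_)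
      |>.congr_of_eventuallyEq ?_
    · ring
    · filter_upwards [isOpen_Ioi.mem_nhds hz] with y hy
      exact (heatExtension_eq hm hlam hf hfi ht hy).2
  have hdxx : HasDerivAt (deriv (kernelIntegral lam (heatKernel lam) f t))
      (c * (p * e) * ((x ^ 2 / (4 * t ^ 2) - 1 / (2 * t)) * G 0 0 q - x / (2 * t ^ 2) * G 0 1 q
        + G 0 2 q / (4 * t ^ 2))) x := by
    have hlin : HasDerivAt (fun z : ℝ => -(z / (2 * t))) (-(1 / (2 * t))) x :=
      ((hasDerivAt_id x).div_const (2 * t)).neg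
    have h := (((hexp x).const_mul p).mul ((hlin.mul (hder 0 x)).add
      ((hder 1 x).div_const (2 * t)))).const_mul c
    refine (h.congr_deriv ?_).congr_of_eventuallyEq ?_
    · simp only [Pi.add_apply, Pi.mul_apply, zero_add, one_add_one_eq_two]
      rw [← hq]
      ring
    · filter_upwards [isOpen_Ioi.mem_nhds hx] with y hy using (hdx y hy).deriv
  rw [besselOp, hdt.deriv, hdxx.deriv, (hdx x hx).deriv, ← hq]
  have hrel := heatTransform_equation hm hlam hf hfi (mem_heatDomain ht (x / (2 * t)))
  rw [← hq, ← hGdef] at hrel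
  have hq2 : q.2 = x / (2 * t) := rfl
  rw [hq2] at hrel
  have h10 : G 1 0 q = -G 0 2 q - 4 * lam * t / x * G 0 1 q := by
    have : x / (2 * t) ≠ 0 := by positivity
    refine mul_left_cancel₀ this ?_
    have h5 : x / (2 * t) * (-G 0 2 q - 4 * lam * t / x * G 0 1 q) =
        -(x / (2 * t) * G 0 2 q) - 2 * lam * G 0 1 q := by
      field_simp; ring
    linarith
  rw [h10]
  change _ = -(-(c * (p * e) * _) - 2 * lam / x * (c * (p * e * _)))
  field_simp
  ring

end HeatTransform

section HeatData

variable {lam : ℝ} {m : Measure ℝ} {T : EReal} {f : ℝ → ℝ}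

theorem integrableOn_heatFactor (hlam : 0 ≤ lam) {t : ℝ} (ht : 0 < t) :
    IntegrableOn (heatFactor lam t) (Ioi 0) := by
  have h := integrableOn_rpow_mul_exp_neg_mul_sq (b := 1 / (4 * t)) (by positivity)
    (s := 2 * lam) (by linarith)
  refine h.mono' ((continuousOn_heatFactor t).aestronglyMeasurable measurableSet_Ioi) ?_
  filter_upwards [ae_restrict_mem measurableSet_Ioi] with y hy
  have hy : 0 < y := hy
  rw [Real.norm_of_nonneg (heatFactor_pos hy).le, heatFactor_eq hy,
    show -y ^ 2 / (4 * t) = -(1 / (4 * t)) * y ^ 2 by ring]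
  gcongr
  exact mul_le_of_le_one_right (by positivity)
    (Real.rpow_le_one_of_one_le_of_nonpos (by linarith) (by linarith))

theorem rpow_neg_half_mul_exp_le {t r : ℝ} (ht : 0 < t) :
    t ^ (-(1 / 2) : ℝ) * Real.exp (-r ^ 2 / (4 * t)) ≤ 4 * (√t / (√t ^ 2 + r ^ 2)) := by
  have h1 : Real.exp (-r ^ 2 / (4 * t)) ≤ (1 + r ^ 2 / (4 * t))⁻¹ := by
    rw [neg_div, Real.exp_neg]
    gcongr
    linarith [Real.add_one_le_exp (r ^ 2 / (4 * t))]
  have hs : 0 < √t := Real.sqrt_pos.2 ht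
  rw [Real.rpow_neg ht.le, ← Real.sqrt_eq_rpow]
  calc (√t)⁻¹ * Real.exp (-r ^ 2 / (4 * t)) ≤ (√t)⁻¹ * (1 + r ^ 2 / (4 * t))⁻¹ := by gcongr
    _ = 4 * (√t / (4 * √t ^ 2 + r ^ 2)) := by
        rw [show 1 + r ^ 2 / (4 * t) = (4 * √t ^ 2 + r ^ 2) / (4 * √t ^ 2) by
          rw [Real.sq_sqrt ht.le]; field_simp]
        field_simp
    _ ≤ _ := by
        gcongr
        nlinarith [sq_nonneg (√t)]

theorem tendsto_rpow_mul_exp_neg_div {a c : ℝ} (hc : 0 < c) :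
    Tendsto (fun t : ℝ => t ^ (-a) * Real.exp (-c / t)) (𝓝[>] 0) (𝓝 0) := by
  have h := (tendsto_rpow_mul_exp_neg_mul_atTop_nhds_zero a c hc).comp tendsto_inv_nhdsGT_zero
  refine h.congr' ?_
  filter_upwards [self_mem_nhdsWithin] with t ht
  have ht : 0 < t := ht
  simp only [Function.comp]
  rw [Real.inv_rpow ht.le, ← Real.rpow_neg ht.le, div_eq_mul_inv]

theorem hasInitialData_heatExtension (hm : IsAngularMeasure lam m) (hlam : 0 ≤ lam) (hT : 0 < T)
    (hf : AEStronglyMeasurable f (volume.restrict (Ioi (0 : ℝ))))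
    (hfi : ∀ t ∈ timeInterval T, IntegrableOn (fun y => heatFactor lam t y * f y) (Ioi 0)) :
    HasInitialData (kernelIntegral lam (heatKernel lam) f) f := by
  obtain ⟨t₁, ht₁⟩ := exists_mem_timeInterval hT
  obtain ⟨t₂, ht₂, h12⟩ := exists_gt_mem_timeInterval ht₁
  have ht₁0 := ht₁.1
  have ht₂0 := ht₂.1
  have hLeb := ae_isLebesguePoint (f := f) fun a b ha =>
    integrableOn_Icc_of_integrableOn_mul (continuousOn_heatFactor t₂)
      (fun y hy => heatFactor_pos hy) (hfi t₂ ht₂) ha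
  obtain ⟨C, hC, hnear⟩ := hm.exists_heatKernel_mul_le hlam
  have hc := heatConst_pos hlam
  filter_upwards [hLeb, ae_restrict_mem measurableSet_Ioi] with x hL hx
  have hx : 0 < x := hx
  have hpos : ∀ᶠ t in 𝓝[>] (0 : ℝ), 0 < t := self_mem_nhdsWithin
  have key := tendsto_integral_mul_of_isLebesguePoint hx hf hL
    (K := fun t y => heatKernel lam t x y * y ^ (2 * lam)) (τ := fun t => √t) (C := C * 4)
    (by positivity) ?_ ?_ ?_ ?_ ?_ ?_ ?_
  · refine key.congr fun t => ?_
    rw [kernelIntegral]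
    congr 1; ext y; ring
  · filter_upwards [hpos] with t ht y hy
    have := hm.heatKernel_nonneg hlam ht hx hy
    positivity
  · filter_upwards [hpos] with t ht using Real.sqrt_pos.2 ht
  · filter_upwards [hpos] with t ht using (hm.integral_heatKernel hlam ht hx).1
  · filter_upwards [eventually_mem_timeInterval hT] with t ht
    have h := (heatExtension_eq hm hlam hf hfi ht hx).1
    refine h.congr_fun (fun y _ => ?_) measurableSet_Ioi
    simp only; ring
  · filter_upwards [hpos] with t ht using (hm.integral_heatKernel hlam ht hx).2
  · filter_upwards [hpos] with t ht y hy hyx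
    refine (hnear t x y ht hx hy hyx).trans ?_
    rw [mul_assoc]
    exact mul_le_mul_of_nonneg_left (rpow_neg_half_mul_exp_le ht) hC
  · intro δ hδ
    obtain ⟨C', hC', hgauss⟩ := exists_gaussian_le_heatFactor hlam
      (one_div_lt_one_div_of_lt (by positivity) (by linarith : 4 * t₁ < 4 * t₂)) (x / (2 * t₁)) 0
    refine ⟨fun t => heatConst lam * Real.exp (δ ^ 2 / (4 * t₁)) * C' *
      (t ^ (-(lam + 1 / 2)) * Real.exp (-(δ ^ 2 / 4) / t)), heatFactor lam t₂, ?_,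
      integrableOn_heatFactor hlam ht₂0, hfi t₂ ht₂, ?_⟩
    · simpa using (tendsto_rpow_mul_exp_neg_div (a := lam + 1 / 2)
        (by positivity : 0 < δ ^ 2 / 4)).const_mul
        (heatConst lam * Real.exp (δ ^ 2 / (4 * t₁)) * C')
    · filter_upwards [Ioc_mem_nhdsGT ht₁0] with t ht y hy hyx
      obtain ⟨ht0, htt⟩ := ht
      have hsq : δ ^ 2 ≤ (y - x) ^ 2 := by rw [← sq_abs (y - x)]; gcongr
      have h1 : Real.exp (-(y - x) ^ 2 / (4 * t)) ≤ Real.exp (δ ^ 2 / (4 * t₁)) *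
          Real.exp (-(δ ^ 2 / 4) / t) * Real.exp (-(1 / (4 * t₁)) * y ^ 2 + x / (2 * t₁) * y) := by
        rw [← Real.exp_add, ← Real.exp_add]
        refine Real.exp_le_exp.2 ?_
        have h2 : 0 ≤ 1 / (4 * t) - 1 / (4 * t₁) :=
          sub_nonneg.2 (one_div_le_one_div_of_le (by positivity) (by linarith))
        have h3 := mul_le_mul_of_nonneg_right hsq h2
        have e1 : -(y - x) ^ 2 / (4 * t) = -((y - x) ^ 2 * (1 / (4 * t) - 1 / (4 * t₁)))
            - (y - x) ^ 2 * (1 / (4 * t₁)) := by ring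
        have e2 : -(δ ^ 2 / 4) / t = -(δ ^ 2 * (1 / (4 * t))) := by field_simp
        have e3 : (y - x) ^ 2 * (1 / (4 * t₁)) =
            1 / (4 * t₁) * y ^ 2 - x / (2 * t₁) * y + x ^ 2 * (1 / (4 * t₁)) := by
          field_simp; ring
        have e4 : 0 ≤ x ^ 2 * (1 / (4 * t₁)) := by positivity
        have e5 : δ ^ 2 / (4 * t₁) = δ ^ 2 * (1 / (4 * t₁)) := by ring
        rw [e1, e2, e3, e5]
        linarith
      have h4 := hgauss y hy
      rw [pow_zero, one_mul] at h4
      calc heatKernel lam t x y * y ^ (2 * lam)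
          ≤ heatConst lam * t ^ (-lam - 1 / 2) * Real.exp (-(y - x) ^ 2 / (4 * t)) *
            y ^ (2 * lam) := by
            gcongr
            exact hm.heatKernel_le hlam ht0 hx hy
        _ ≤ heatConst lam * t ^ (-lam - 1 / 2) * (Real.exp (δ ^ 2 / (4 * t₁)) *
            Real.exp (-(δ ^ 2 / 4) / t) * Real.exp (-(1 / (4 * t₁)) * y ^ 2 + x / (2 * t₁) * y)) *
            y ^ (2 * lam) := by gcongr
        _ = heatConst lam * t ^ (-lam - 1 / 2) * (Real.exp (δ ^ 2 / (4 * t₁)) *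
            Real.exp (-(δ ^ 2 / 4) / t)) *
            (Real.exp (-(1 / (4 * t₁)) * y ^ 2 + x / (2 * t₁) * y) * y ^ (2 * lam)) := by ring
        _ ≤ heatConst lam * t ^ (-lam - 1 / 2) * (Real.exp (δ ^ 2 / (4 * t₁)) *
            Real.exp (-(δ ^ 2 / 4) / t)) * (C' * heatFactor lam t₂ y) := by gcongr
        _ = _ := by
            rw [show -(lam + 1 / 2) = -lam - 1 / 2 by ring]
            ring

theorem exists_heatFactor_le (hm : IsAngularMeasure lam m) (hlam : 0 ≤ lam) {t : ℝ} (ht : 0 < t) :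
    ∃ C, ∀ y, 0 < y → heatFactor lam t y ≤ C * (heatKernel lam t 1 y * y ^ (2 * lam)) := by
  have hc := heatConst_pos hlam
  set A := heatConst lam * t ^ (-lam - 1 / 2) * Real.exp (-1 / (4 * t)) with hA
  have hA0 : 0 < A := by positivity
  refine ⟨A⁻¹, fun y hy => ?_⟩
  have h := hm.le_heatKernel hlam ht one_pos hy
  rw [show -((1 : ℝ) ^ 2 + y ^ 2) / (4 * t) = -1 / (4 * t) + -y ^ 2 / (4 * t) by ring,
    Real.exp_add, ← mul_assoc, ← hA] at h
  rw [heatFactor_eq hy]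
  calc _ ≤ y ^ (2 * lam) * 1 * Real.exp (-y ^ 2 / (4 * t)) := by
        gcongr
        exact Real.rpow_le_one_of_one_le_of_nonpos (by linarith) (by linarith)
    _ = A⁻¹ * ((A * Real.exp (-y ^ 2 / (4 * t))) * y ^ (2 * lam)) := by field_simp
    _ ≤ _ := by gcongr

end HeatData

section PoissonFactor

variable {lam : ℝ}

theorem poissonFactor_eq {y : ℝ} :
    poissonFactor lam y = (1 + y ^ 2) ^ (-lam - 1) * y ^ (2 * lam) := by
  rw [poissonFactor, show -lam - 1 = -(lam + 1) by ring, Real.rpow_neg (by positivity),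
    add_comm 1 (y ^ 2)]
  ring

theorem poissonFactor_pos {y : ℝ} (hy : 0 < y) : 0 < poissonFactor lam y := by
  unfold poissonFactor; positivity

theorem continuousOn_poissonFactor : ContinuousOn (poissonFactor lam) (Ioi 0) := by
  unfold poissonFactor
  refine ContinuousOn.div (continuousOn_id.rpow_const fun y hy => Or.inl (ne_of_gt hy))
    (ContinuousOn.rpow_const (by fun_prop) fun y _ => Or.inl ?_) fun y _ => ?_
  all_goals positivity

theorem integrableOn_poissonFactor (hlam : 0 ≤ lam) : IntegrableOn (poissonFactor lam) (Ioi 0) := by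
  refine integrable_inv_one_add_sq.integrableOn.mono'
    (continuousOn_poissonFactor.aestronglyMeasurable measurableSet_Ioi) ?_
  filter_upwards [ae_restrict_mem measurableSet_Ioi] with y hy
  have hy : 0 < y := hy
  rw [Real.norm_of_nonneg (poissonFactor_pos hy).le, poissonFactor_eq, Real.rpow_sub_one
    (by positivity), Real.rpow_neg (by positivity), Real.rpow_mul hy.le, Real.rpow_two]
  have h : (y ^ 2) ^ lam ≤ (1 + y ^ 2) ^ lam :=
    Real.rpow_le_rpow (by positivity) (by linarith) hlam
  have h0 : 0 < (1 + y ^ 2) ^ lam := by positivity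
  calc _ ≤ ((1 + y ^ 2) ^ lam)⁻¹ / (1 + y ^ 2) * (1 + y ^ 2) ^ lam := by gcongr
    _ = _ := by field_simp

end PoissonFactor

/-- The integrand of the `(j, k)`-th partial derivative of
`(a, b) ↦ ∫∫ (a + y² - b s y)^{-λ-1} f(y) y^{2λ} dm(s) dy`. -/
noncomputable def poissonIntegrand (lam : ℝ) (f : ℝ → ℝ) (j k : ℕ) (q w : ℝ × ℝ) : ℝ :=
  (-1) ^ j * (w.2 * w.1) ^ k * (∏ i ∈ Finset.range (j + k), (lam + 1 + i)) *
    (q.1 + w.1 ^ 2 - q.2 * (w.2 * w.1)) ^ (-lam - 1 - (j + k : ℕ)) * (f w.1 * w.1 ^ (2 * lam))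

/-- The partial derivatives of the transform representing the Poisson extension. -/
noncomputable def poissonTransform (lam : ℝ) (m : Measure ℝ) (f : ℝ → ℝ) (j k : ℕ)
    (q : ℝ × ℝ) : ℝ :=
  ∫ w, poissonIntegrand lam f j k q w ∂((volume.restrict (Ioi (0 : ℝ))).prod m)

/-- The domain of the transform representing the Poisson extension. -/
def poissonDomain : Set (ℝ × ℝ) := {q | q.2 ^ 2 < 4 * q.1}

theorem isOpen_poissonDomain : IsOpen poissonDomain :=
  isOpen_lt (by fun_prop) (by fun_prop)

theorem mem_poissonDomain {t : ℝ} (ht : 0 < t) (x : ℝ) :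
    (t ^ 2 + x ^ 2, 2 * x) ∈ poissonDomain := by
  change (2 * x) ^ 2 < 4 * (t ^ 2 + x ^ 2)
  nlinarith [sq_pos_of_pos ht]

/-- Locally uniform lower bound for the phase on the domain. -/
theorem exists_le_poissonPhase {q : ℝ × ℝ} (hq : q ∈ poissonDomain) :
    ∃ V ∈ 𝓝 q, ∃ κ, 0 < κ ∧ ∀ q' ∈ V, ∀ y s : ℝ, 0 < y → s ∈ Icc (-1 : ℝ) 1 →
      κ * (1 + y ^ 2) ≤ q'.1 + y ^ 2 - q'.2 * (s * y) := by
  have hq : q.2 ^ 2 < 4 * q.1 := hq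
  set d := q.1 - q.2 ^ 2 / 4 with hd
  have hd0 : 0 < d := by simp only [hd]; linarith
  set a := q.2 ^ 2 / 4 + d / 2 with ha
  have ha0 : 0 < a := by positivity
  set κ := d / (4 * (a + 1)) with hκ
  have hκ0 : 0 < κ := by positivity
  have hκe : κ * (4 * (a + 1)) = d := by simp only [hκ]; field_simp
  have hκ1 : κ < 1 := by
    rw [hκ, div_lt_one (by positivity), ha]
    nlinarith [sq_nonneg q.2]
  refine ⟨{q' | a < q'.1 ∧ q'.2 ^ 2 < q.2 ^ 2 + d}, ?_, κ, hκ0, ?_⟩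
  · refine ((isOpen_lt continuous_const continuous_fst).inter
      (isOpen_lt (by fun_prop : Continuous fun q' : ℝ × ℝ => q'.2 ^ 2)
        continuous_const)).mem_nhds ⟨?_, ?_⟩
    · change a < q.1
      simp only [ha]; linarith
    · change q.2 ^ 2 < q.2 ^ 2 + d
      linarith
  · rintro q' ⟨h1, h2⟩ y s hy hs
    have h3 : q'.2 * (s * y) ≤ |q'.2| * y := by
      calc q'.2 * (s * y) ≤ |q'.2 * (s * y)| := le_abs_self _
        _ = |q'.2| * (|s| * y) := by rw [abs_mul, abs_mul, abs_of_pos hy]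
        _ ≤ |q'.2| * (1 * y) := by gcongr; exact abs_le.2 hs
        _ = _ := by ring
    have h4 : 0 ≤ (1 - κ) * y ^ 2 - |q'.2| * y + (a - κ) := by
      have h5 : 0 ≤ 4 * (1 - κ) * ((1 - κ) * y ^ 2 - |q'.2| * y + (a - κ)) := by
        have h6 : q'.2 ^ 2 = |q'.2| ^ 2 := (sq_abs _).symm
        have h7 : 4 * a = q.2 ^ 2 + 2 * d := by simp only [ha]; ring
        nlinarith [sq_nonneg (2 * (1 - κ) * y - |q'.2|), sq_nonneg κ]
      exact nonneg_of_mul_nonneg_right h5 (by linarith)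
    linarith

theorem hasFDerivAt_poissonIntegrand (lam : ℝ) (f : ℝ → ℝ) (j k : ℕ) {q w : ℝ × ℝ}
    (hA : 0 < q.1 + w.1 ^ 2 - q.2 * (w.2 * w.1)) :
    HasFDerivAt (fun q => poissonIntegrand lam f j k q w)
      (poissonIntegrand lam f (j + 1) k q w • ContinuousLinearMap.fst ℝ ℝ ℝ
        + poissonIntegrand lam f j (k + 1) q w • ContinuousLinearMap.snd ℝ ℝ ℝ) q := by
  have h1 : HasFDerivAt (fun q : ℝ × ℝ => q.1 + w.1 ^ 2 - q.2 * (w.2 * w.1))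
      (ContinuousLinearMap.fst ℝ ℝ ℝ - (w.2 * w.1) • ContinuousLinearMap.snd ℝ ℝ ℝ) q := by
    have h := (hasFDerivAt_fst (𝕜 := ℝ) (E := ℝ) (F := ℝ) (p := q)).add_const (w.1 ^ 2)
    have h' := (hasFDerivAt_snd (𝕜 := ℝ) (E := ℝ) (F := ℝ) (p := q)).const_mul (w.2 * w.1)
    refine (h.sub h').congr_of_eventuallyEq (Eventually.of_forall fun q => ?_)
    simp only [Pi.sub_apply]
    ring
  have h2 := ((h1.rpow_const (p := -lam - 1 - (j + k : ℕ)) (Or.inl hA.ne')).const_mul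
    ((-1) ^ j * (w.2 * w.1) ^ k * ∏ i ∈ Finset.range (j + k), (lam + 1 + i))).mul_const
    (f w.1 * w.1 ^ (2 * lam))
  refine h2.congr_fderiv ?_
  have e1 : j + 1 + k = j + k + 1 := by ring
  have e2 : j + (k + 1) = j + k + 1 := by ring
  have e3 : -lam - 1 - ((j + k + 1 : ℕ) : ℝ) = -lam - 1 - ((j + k : ℕ) : ℝ) - 1 := by
    push_cast; ring
  ext
  · simp only [poissonIntegrand, e1, e2, e3, Finset.prod_range_succ]
    simp
    ring
  · simp only [poissonIntegrand, e1, e2, e3, Finset.prod_range_succ]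
    simp
    ring

section PoissonTransform

variable {lam : ℝ} {m : Measure ℝ} {T : EReal} {f : ℝ → ℝ}

theorem aestronglyMeasurable_poissonIntegrand [IsProbabilityMeasure m]
    (hf : AEStronglyMeasurable f (volume.restrict (Ioi (0 : ℝ)))) (j k : ℕ) (q : ℝ × ℝ) :
    AEStronglyMeasurable (poissonIntegrand lam f j k q)
      ((volume.restrict (Ioi (0 : ℝ))).prod m) := by
  unfold poissonIntegrand
  refine AEStronglyMeasurable.mul (Measurable.aestronglyMeasurable (by fun_prop))
    (hf.comp_fst.mul (Measurable.aestronglyMeasurable (by fun_prop)))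

theorem poissonIntegrand_dominated (hm : IsAngularMeasure lam m) (hlam : 0 ≤ lam)
    (hfi : IntegrableOn (fun y => poissonFactor lam y * f y) (Ioi 0))
    (j k : ℕ) {q : ℝ × ℝ} (hq : q ∈ poissonDomain) :
    ∃ V ∈ 𝓝 q, ∃ bound : ℝ × ℝ → ℝ,
      Integrable bound ((volume.restrict (Ioi (0 : ℝ))).prod m) ∧
      ∀ᵐ w ∂((volume.restrict (Ioi (0 : ℝ))).prod m), ∀ q' ∈ V,
        |poissonIntegrand lam f j k q' w| ≤ bound w := by
  have := hm.prob
  obtain ⟨V, hV, κ, hκ, hle⟩ := exists_le_poissonPhase hq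
  set c := ∏ i ∈ Finset.range (j + k), (lam + 1 + (i : ℝ)) with hc
  have hc0 : 0 ≤ c := Finset.prod_nonneg fun i _ => by positivity
  refine ⟨V, hV, fun w => c * κ ^ (-lam - 1 - (j + k : ℕ)) * |poissonFactor lam w.1 * f w.1|,
    ?_, ?_⟩
  · have h := (hfi.abs.const_mul (c * κ ^ (-lam - 1 - (j + k : ℕ)))).comp_fst m
    exact h
  · filter_upwards [hm.ae_prod_mem] with w hw q' hq'
    obtain ⟨hw1, hw2⟩ := hw
    have hs : |w.2| ≤ 1 := abs_le.2 hw2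
    have hA := hle q' hq' w.1 w.2 hw1 hw2
    have hA0 : 0 < q'.1 + w.1 ^ 2 - q'.2 * (w.2 * w.1) := lt_of_lt_of_le (by positivity) hA
    simp only [poissonIntegrand]
    have e1 : |(-1 : ℝ) ^ j * (w.2 * w.1) ^ k| ≤ (1 + w.1 ^ 2) ^ (j + k) := by
      rw [abs_mul, abs_pow, abs_pow, abs_neg, abs_one, one_pow, one_mul, abs_mul, abs_of_pos hw1]
      calc (|w.2| * w.1) ^ k ≤ (1 + w.1 ^ 2) ^ k := by
            gcongr
            nlinarith [sq_nonneg (w.1 - 1), abs_nonneg w.2]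
        _ ≤ _ := pow_le_pow_right₀ (by nlinarith [sq_nonneg w.1]) (by omega)
    have e2 : (q'.1 + w.1 ^ 2 - q'.2 * (w.2 * w.1)) ^ (-lam - 1 - (j + k : ℕ)) ≤
        κ ^ (-lam - 1 - (j + k : ℕ)) * (1 + w.1 ^ 2) ^ (-lam - 1 - (j + k : ℕ)) := by
      rw [← Real.mul_rpow hκ.le (by positivity)]
      refine Real.rpow_le_rpow_of_nonpos (by positivity) hA ?_
      have : (0 : ℝ) ≤ (j + k : ℕ) := by positivity
      linarith
    have e3 : (1 + w.1 ^ 2) ^ (-lam - 1 - (j + k : ℕ)) * (1 + w.1 ^ 2) ^ (j + k) =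
        (1 + w.1 ^ 2) ^ (-lam - 1) := by
      rw [← Real.rpow_natCast _ (j + k), ← Real.rpow_add (by positivity)]; congr 1; ring
    rw [abs_mul, abs_mul, abs_mul _ (∏ i ∈ Finset.range (j + k), (lam + 1 + (i : ℝ))),
      abs_mul (f w.1), ← hc, abs_of_nonneg hc0, abs_of_pos (Real.rpow_pos_of_pos hA0 _),
      abs_of_pos (Real.rpow_pos_of_pos hw1 _), abs_mul (poissonFactor lam w.1),
      abs_of_pos (poissonFactor_pos hw1), poissonFactor_eq, ← e3]
    calc _ ≤ (1 + w.1 ^ 2) ^ (j + k) * c * (κ ^ (-lam - 1 - (j + k : ℕ)) *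
          (1 + w.1 ^ 2) ^ (-lam - 1 - (j + k : ℕ))) * (|f w.1| * w.1 ^ (2 * lam)) := by gcongr
      _ = _ := by ring

theorem integrable_poissonIntegrand (hm : IsAngularMeasure lam m) (hlam : 0 ≤ lam)
    (hf : AEStronglyMeasurable f (volume.restrict (Ioi (0 : ℝ))))
    (hfi : IntegrableOn (fun y => poissonFactor lam y * f y) (Ioi 0))
    (j k : ℕ) {q : ℝ × ℝ} (hq : q ∈ poissonDomain) :
    Integrable (poissonIntegrand lam f j k q) ((volume.restrict (Ioi (0 : ℝ))).prod m) := by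
  have := hm.prob
  obtain ⟨V, hV, b, hb, hle⟩ := poissonIntegrand_dominated hm hlam hfi j k hq
  refine hb.mono' (aestronglyMeasurable_poissonIntegrand hf j k q) ?_
  filter_upwards [hle] with w h using h q (mem_of_mem_nhds hV)

theorem poissonPhase_pos {q : ℝ × ℝ} (hq : q ∈ poissonDomain) {y s : ℝ} (hy : 0 < y)
    (hs : s ∈ Icc (-1 : ℝ) 1) : 0 < q.1 + y ^ 2 - q.2 * (s * y) := by
  obtain ⟨V, hV, κ, hκ, hle⟩ := exists_le_poissonPhase hq
  exact lt_of_lt_of_le (by positivity) (hle q (mem_of_mem_nhds hV) y s hy hs)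

theorem hasFDerivAt_poissonTransform (hm : IsAngularMeasure lam m) (hlam : 0 ≤ lam)
    (hf : AEStronglyMeasurable f (volume.restrict (Ioi (0 : ℝ))))
    (hfi : IntegrableOn (fun y => poissonFactor lam y * f y) (Ioi 0))
    (j k : ℕ) {q : ℝ × ℝ} (hq : q ∈ poissonDomain) :
    HasFDerivAt (poissonTransform lam m f j k)
      (poissonTransform lam m f (j + 1) k q • ContinuousLinearMap.fst ℝ ℝ ℝ
        + poissonTransform lam m f j (k + 1) q • ContinuousLinearMap.snd ℝ ℝ ℝ) q := by
  have := hm.prob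
  refine hasFDerivAt_integral_of_family isOpen_poissonDomain (F := poissonIntegrand lam f)
    (fun j k q _ => aestronglyMeasurable_poissonIntegrand hf j k q)
    (fun j k => ?_)
    (fun j k q hq => poissonIntegrand_dominated hm hlam hfi j k hq) j k hq
  filter_upwards [hm.ae_prod_mem] with w hw q hq
  exact hasFDerivAt_poissonIntegrand lam f j k (poissonPhase_pos hq hw.1 hw.2)

/-- The equation satisfied by the transform representing the Poisson extension. -/
theorem poissonTransform_equation (hm : IsAngularMeasure lam m) (hlam : 0 ≤ lam)
    (hf : AEStronglyMeasurable f (volume.restrict (Ioi (0 : ℝ))))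
    (hfi : IntegrableOn (fun y => poissonFactor lam y * f y) (Ioi 0))
    {q : ℝ × ℝ} (hq : q ∈ poissonDomain) :
    q.2 * (2 + lam) * poissonTransform lam m f 1 0 q + q.2 * q.1 * poissonTransform lam m f 2 0 q
      + q.2 ^ 2 * poissonTransform lam m f 1 1 q + q.2 * poissonTransform lam m f 0 2 q
      + 2 * lam * poissonTransform lam m f 0 1 q = 0 := by
  have := hm.prob
  have hi := fun j k => integrable_poissonIntegrand hm hlam hf hfi j k hq
  set F := fun j k => poissonIntegrand lam f j k q with hF
  have hi₂ : Integrable (fun w => q.2 * (2 + lam) * F 1 0 w + q.2 * q.1 * F 2 0 w)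
      ((volume.restrict (Ioi (0 : ℝ))).prod m) :=
    ((hi 1 0).const_mul _).add ((hi 2 0).const_mul _)
  have hi₃ : Integrable (fun w => q.2 * (2 + lam) * F 1 0 w + q.2 * q.1 * F 2 0 w
      + q.2 ^ 2 * F 1 1 w) ((volume.restrict (Ioi (0 : ℝ))).prod m) :=
    hi₂.add ((hi 1 1).const_mul _)
  have hi₄ : Integrable (fun w => q.2 * (2 + lam) * F 1 0 w + q.2 * q.1 * F 2 0 w
      + q.2 ^ 2 * F 1 1 w + q.2 * F 0 2 w) ((volume.restrict (Ioi (0 : ℝ))).prod m) :=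
    hi₃.add ((hi 0 2).const_mul _)
  have hi₅ : Integrable (fun w => q.2 * (2 + lam) * F 1 0 w + q.2 * q.1 * F 2 0 w
      + q.2 ^ 2 * F 1 1 w + q.2 * F 0 2 w + 2 * lam * F 0 1 w)
      ((volume.restrict (Ioi (0 : ℝ))).prod m) :=
    hi₄.add ((hi 0 1).const_mul _)
  simp only [poissonTransform]
  rw [← integral_const_mul, ← integral_const_mul, ← integral_const_mul, ← integral_const_mul,
    ← integral_const_mul, ← integral_add ((hi 1 0).const_mul _) ((hi 2 0).const_mul _),
    ← integral_add hi₂ ((hi 1 1).const_mul _), ← integral_add hi₃ ((hi 0 2).const_mul _),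
    ← integral_add hi₄ ((hi 0 1).const_mul _), integral_prod _ hi₅]
  refine integral_eq_zero_of_ae ?_
  filter_upwards [ae_restrict_mem measurableSet_Ioi] with y hy
  have hpos : ∀ s ∈ Icc (-1 : ℝ) 1, 0 < q.1 + y ^ 2 - q.2 * (s * y) := fun s hs =>
    poissonPhase_pos hq hy hs
  have hcont : ∀ a : ℝ, ContinuousOn (fun s : ℝ => (q.1 + y ^ 2 - q.2 * (s * y)) ^ a)
      (Icc (-1) 1) := fun a =>
    ContinuousOn.rpow_const (by fun_prop) fun s hs => Or.inl (hpos s hs).ne'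
  have hcont2 := hcont (-lam - 2)
  have hcont3 := hcont (-lam - 2 - 1)
  have h := hm.ibp (fun s => (q.1 + y ^ 2 - q.2 * (s * y)) ^ (-lam - 2))
    (fun s => (lam + 2) * (q.2 * y) * (q.1 + y ^ 2 - q.2 * (s * y)) ^ (-lam - 2 - 1))
    (fun s hs => by
      have h1 : HasDerivAt (fun s : ℝ => q.1 + y ^ 2 - q.2 * (s * y)) (-(q.2 * y)) s := by
        simpa using (((hasDerivAt_id s).mul_const y).const_mul q.2).const_sub (q.1 + y ^ 2)
      refine (h1.rpow_const (p := -lam - 2) (Or.inl (hpos s hs).ne')).congr_deriv ?_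
      ring) (by fun_prop)
  have e : ∀ᵐ s ∂m, q.2 * (2 + lam) * F 1 0 (y, s) + q.2 * q.1 * F 2 0 (y, s)
      + q.2 ^ 2 * F 1 1 (y, s) + q.2 * F 0 2 (y, s) + 2 * lam * F 0 1 (y, s) =
      ((lam + 1) * (f y * y ^ (2 * lam)) * y) *
        (2 * lam * (s * (q.1 + y ^ 2 - q.2 * (s * y)) ^ (-lam - 2))
          - (1 - s ^ 2) * ((lam + 2) * (q.2 * y) *
            (q.1 + y ^ 2 - q.2 * (s * y)) ^ (-lam - 2 - 1))) := by
    filter_upwards [hm.mem] with s hs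
    have hA := hpos s hs
    have x1 : -lam - 1 - ((1 : ℕ) : ℝ) = -lam - 2 := by push_cast; ring
    have x2 : -lam - 1 - ((2 : ℕ) : ℝ) = -lam - 2 - 1 := by push_cast; ring
    have x3 : (q.1 + y ^ 2 - q.2 * (s * y)) ^ (-lam - 2) =
        (q.1 + y ^ 2 - q.2 * (s * y)) ^ (-lam - 2 - 1) * (q.1 + y ^ 2 - q.2 * (s * y)) := by
      rw [Real.rpow_sub_one hA.ne', div_mul_cancel₀ _ hA.ne']
    simp only [hF, poissonIntegrand, add_zero, zero_add, Nat.reduceAdd, Finset.prod_range_succ,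
      Finset.prod_range_zero, x1, x2, x3]
    push_cast
    ring
  rw [integral_congr_ae e, Pi.zero_apply, integral_const_mul,
    integral_sub ((hm.integrable (by fun_prop)).const_mul _) (hm.integrable (by fun_prop)),
    integral_const_mul, h, sub_self, mul_zero]

theorem poissonExtension_eq (hm : IsAngularMeasure lam m) (hlam : 0 ≤ lam)
    (hf : AEStronglyMeasurable f (volume.restrict (Ioi (0 : ℝ))))
    (hfi : IntegrableOn (fun y => poissonFactor lam y * f y) (Ioi 0))
    {t x : ℝ} (ht : 0 < t) (hx : 0 < x) :
    IntegrableOn (fun y => poissonKernel lam t x y * f y * y ^ (2 * lam)) (Ioi 0) ∧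
    kernelIntegral lam (poissonKernel lam) f t x = poissonConst lam *
      (t * poissonTransform lam m f 0 0 (t ^ 2 + x ^ 2, 2 * x)) := by
  have := hm.prob
  have hi := integrable_poissonIntegrand hm hlam hf hfi 0 0 (mem_poissonDomain ht x)
  have he : EqOn (fun y => poissonConst lam * t *
      ∫ s, poissonIntegrand lam f 0 0 (t ^ 2 + x ^ 2, 2 * x) (y, s) ∂m)
      (fun y => poissonKernel lam t x y * f y * y ^ (2 * lam)) (Ioi 0) := by
    intro y hy
    simp only [poissonIntegrand]
    rw [hm.poissonKernel_eq hlam ht hx hy]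
    have e1 : ∀ s : ℝ, (-1 : ℝ) ^ 0 * (s * y) ^ 0 *
        (∏ i ∈ Finset.range (0 + 0), (lam + 1 + (i : ℝ))) *
        (t ^ 2 + x ^ 2 + y ^ 2 - 2 * x * (s * y)) ^ (-lam - 1 - ((0 + 0 : ℕ) : ℝ)) *
        (f y * y ^ (2 * lam)) = (f y * y ^ (2 * lam)) *
          (t ^ 2 + x ^ 2 + y ^ 2 - 2 * x * y * s) ^ (-lam - 1) := by
      intro s
      rw [show 2 * x * (s * y) = 2 * x * y * s by ring]
      simp
      ring
    simp_rw [e1]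
    rw [integral_const_mul]
    ring
  constructor
  · exact IntegrableOn.congr_fun (s := Ioi 0) (hi.integral_prod_left.const_mul _) he
      measurableSet_Ioi
  · rw [kernelIntegral, ← setIntegral_congr_fun measurableSet_Ioi he, integral_const_mul,
      poissonTransform, integral_prod _ hi]
    ring

theorem smoothOn_poissonExtension (hm : IsAngularMeasure lam m) (hlam : 0 ≤ lam)
    (hf : AEStronglyMeasurable f (volume.restrict (Ioi (0 : ℝ))))
    (hfi : IntegrableOn (fun y => poissonFactor lam y * f y) (Ioi 0)) :
    SmoothOn T (kernelIntegral lam (poissonKernel lam) f) := by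
  have hG := contDiffOn_of_family isOpen_poissonDomain (G := poissonTransform lam m f)
    (fun j k q hq => hasFDerivAt_poissonTransform hm hlam hf hfi j k hq) 0 0
  have hmap : ContDiffOn ℝ ∞ (fun q : ℝ × ℝ => (q.1 ^ 2 + q.2 ^ 2, 2 * q.2))
      (timeInterval T ×ˢ Ioi (0 : ℝ)) := by fun_prop
  have hcomp := hG.comp hmap fun q hq => mem_poissonDomain hq.1.1 q.2
  refine ContDiffOn.congr (f := fun q : ℝ × ℝ => poissonConst lam *
      (q.1 * poissonTransform lam m f 0 0 (q.1 ^ 2 + q.2 ^ 2, 2 * q.2))) ?_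
    fun q hq => (poissonExtension_eq hm hlam hf hfi hq.1.1 hq.2).2
  exact contDiffOn_const.mul (contDiffOn_fst.mul hcomp)

theorem poissonEq_poissonExtension (hm : IsAngularMeasure lam m) (hlam : 0 ≤ lam)
    (hf : AEStronglyMeasurable f (volume.restrict (Ioi (0 : ℝ))))
    (hfi : IntegrableOn (fun y => poissonFactor lam y * f y) (Ioi 0)) :
    PoissonEq lam T (kernelIntegral lam (poissonKernel lam) f) := by
  intro t ht x hx
  have ht0 := ht.1
  set c := poissonConst lam
  set G := poissonTransform lam m f with hGdef
  have hG : ∀ j k, ∀ q ∈ poissonDomain, HasFDerivAt (G j k)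
      (G (j + 1) k q • ContinuousLinearMap.fst ℝ ℝ ℝ
        + G j (k + 1) q • ContinuousLinearMap.snd ℝ ℝ ℝ) q :=
    fun j k q hq => hasFDerivAt_poissonTransform hm hlam hf hfi j k hq
  have hsq : ∀ z : ℝ, HasDerivAt (fun z : ℝ => z ^ 2) (2 * z) z := fun z => by
    simpa using hasDerivAt_pow 2 z
  have hderT : ∀ j k s, 0 < s → HasDerivAt (fun s => G j k (s ^ 2 + x ^ 2, 2 * x))
      (2 * s * G (j + 1) k (s ^ 2 + x ^ 2, 2 * x)) s := by
    intro j k s hs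
    have h := hasDerivAt_comp_pair (G := G j k) (a := fun s => s ^ 2 + x ^ 2)
      (b := fun _ => 2 * x) (hG j k _ (mem_poissonDomain hs x)) ((hsq s).add_const _)
      (hasDerivAt_const s _)
    exact h.congr_deriv (by ring)
  have hderX : ∀ j k z, HasDerivAt (fun z => G j k (t ^ 2 + z ^ 2, 2 * z))
      (2 * z * G (j + 1) k (t ^ 2 + z ^ 2, 2 * z) + 2 * G j (k + 1) (t ^ 2 + z ^ 2, 2 * z)) z := by
    intro j k z
    have h := hasDerivAt_comp_pair (G := G j k) (a := fun z => t ^ 2 + z ^ 2)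
      (b := fun z => 2 * z) (hG j k _ (mem_poissonDomain ht0 z)) ((hsq z).const_add _)
      ((hasDerivAt_id z).const_mul 2)
    exact h.congr_deriv (by ring)
  set q : ℝ × ℝ := (t ^ 2 + x ^ 2, 2 * x) with hq
  have hdt : ∀ s, 0 < s → HasDerivAt (fun s => kernelIntegral lam (poissonKernel lam) f s x)
      (c * (G 0 0 (s ^ 2 + x ^ 2, 2 * x) + 2 * s ^ 2 * G 1 0 (s ^ 2 + x ^ 2, 2 * x))) s := by
    intro s hs
    refine ((((hasDerivAt_id s).mul (hderT 0 0 s hs)).const_mul c).congr_deriv ?_)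
      |>.congr_of_eventuallyEq ?_
    · simp only [id]; ring
    · filter_upwards [isOpen_Ioi.mem_nhds hs] with r hr
      exact (poissonExtension_eq hm hlam hf hfi hr hx).2
  have hdtt : HasDerivAt (deriv fun s => kernelIntegral lam (poissonKernel lam) f s x)
      (c * (6 * t * G 1 0 q + 4 * t ^ 3 * G 2 0 q)) t := by
    have h := ((hderT 0 0 t ht0).add (((hsq t).const_mul 2).mul (hderT 1 0 t ht0))).const_mul c
    refine (h.congr_deriv ?_).congr_of_eventuallyEq ?_
    · simp only [zero_add, one_add_one_eq_two]
      ring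
    · filter_upwards [isOpen_Ioi.mem_nhds ht0] with r hr using (hdt r hr).deriv
  have hdx : ∀ z, 0 < z → HasDerivAt (kernelIntegral lam (poissonKernel lam) f t)
      (c * (t * (2 * z * G 1 0 (t ^ 2 + z ^ 2, 2 * z) + 2 * G 0 1 (t ^ 2 + z ^ 2, 2 * z)))) z := by
    intro z hz
    refine (((hderX 0 0 z).const_mul t).const_mul c).congr_of_eventuallyEq ?_
    filter_upwards [isOpen_Ioi.mem_nhds hz] with y hy
    exact (poissonExtension_eq hm hlam hf hfi ht0 hy).2
  have hdxx : HasDerivAt (deriv (kernelIntegral lam (poissonKernel lam) f t))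
      (c * (t * (2 * G 1 0 q + 2 * x * (2 * x * G 2 0 q + 2 * G 1 1 q)
        + 2 * (2 * x * G 1 1 q + 2 * G 0 2 q)))) x := by
    have h := ((((hasDerivAt_id x).const_mul 2).mul (hderX 1 0 x)).add
      ((hderX 0 1 x).const_mul 2)).const_mul t |>.const_mul c
    refine (h.congr_deriv ?_).congr_of_eventuallyEq ?_
    · simp only [zero_add, one_add_one_eq_two, id, mul_one]
      rfl
    · filter_upwards [isOpen_Ioi.mem_nhds hx] with y hy using (hdx y hy).deriv
  rw [besselOp, hdtt.deriv, hdxx.deriv, (hdx x hx).deriv, ← hq]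
  have hrel := poissonTransform_equation hm hlam hf hfi (mem_poissonDomain ht0 x)
  rw [← hq, ← hGdef] at hrel
  simp only [hq] at hrel
  rw [← hq] at hrel
  have h02 : G 0 2 q = -((2 + lam) * G 1 0 q) - (t ^ 2 + x ^ 2) * G 2 0 q - 2 * x * G 1 1 q
      - lam / x * G 0 1 q := by
    have : 2 * x ≠ 0 := by positivity
    refine mul_left_cancel₀ this ?_
    have h5 : 2 * x * (lam / x * G 0 1 q) = 2 * lam * G 0 1 q := by field_simp
    linarith
  rw [h02]
  field_simp
  ring

theorem hasInitialData_poissonExtension (hm : IsAngularMeasure lam m) (hlam : 0 ≤ lam)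
    (hf : AEStronglyMeasurable f (volume.restrict (Ioi (0 : ℝ))))
    (hfi : IntegrableOn (fun y => poissonFactor lam y * f y) (Ioi 0)) :
    HasInitialData (kernelIntegral lam (poissonKernel lam) f) f := by
  have hLeb := ae_isLebesguePoint (f := f) fun a b ha =>
    integrableOn_Icc_of_integrableOn_mul continuousOn_poissonFactor
      (fun y hy => poissonFactor_pos hy) hfi ha
  obtain ⟨C, hC, hnear⟩ := hm.exists_poissonKernel_mul_le hlam
  have hc := poissonConst_pos hlam
  filter_upwards [hLeb, ae_restrict_mem measurableSet_Ioi] with x hL hx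
  have hx : 0 < x := hx
  have hpos : ∀ᶠ t in 𝓝[>] (0 : ℝ), 0 < t := self_mem_nhdsWithin
  have key := tendsto_integral_mul_of_isLebesguePoint hx hf hL
    (K := fun t y => poissonKernel lam t x y * y ^ (2 * lam)) (τ := fun t => t) (C := C)
    hC ?_ hpos ?_ ?_ ?_ ?_ ?_
  · refine key.congr fun t => ?_
    rw [kernelIntegral]
    congr 1; ext y; ring
  · filter_upwards [hpos] with t ht y hy
    have := hm.poissonKernel_nonneg hlam ht hx hy
    positivity
  · filter_upwards [hpos] with t ht using (hm.integral_poissonKernel hlam ht hx).1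
  · filter_upwards [hpos] with t ht
    have h := (poissonExtension_eq hm hlam hf hfi ht hx).1
    refine h.congr_fun (fun y _ => ?_) measurableSet_Ioi
    simp only; ring
  · filter_upwards [hpos] with t ht using (hm.integral_poissonKernel hlam ht hx).2
  · filter_upwards [hpos] with t ht y hy hyx using hnear t x y ht hx hy hyx
  · intro δ hδ
    set A := 1 / δ ^ 2 + (1 + x / δ) ^ 2 with hA
    have hA0 : 0 < A := by positivity
    refine ⟨fun t => poissonConst lam * A⁻¹ ^ (-lam - 1) * t, poissonFactor lam, ?_,
      integrableOn_poissonFactor hlam, hfi, ?_⟩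
    · have h : Tendsto (fun t : ℝ => poissonConst lam * A⁻¹ ^ (-lam - 1) * t) (𝓝 0)
          (𝓝 (poissonConst lam * A⁻¹ ^ (-lam - 1) * 0)) := tendsto_id.const_mul _
      rw [mul_zero] at h
      exact h.mono_left nhdsWithin_le_nhds
    · filter_upwards [hpos] with t ht y hy hyx
      set r := |y - x| with hr
      have hr0 : 0 < r := hδ.trans hyx
      have hrδ : 1 ≤ r / δ := (one_le_div hδ).2 hyx.le
      have h1 : y ≤ r * (1 + x / δ) := by
        have h2 : y - x ≤ r := le_abs_self _
        have h3 : x ≤ r * (x / δ) := by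
          rw [show r * (x / δ) = r / δ * x by ring]
          exact le_mul_of_one_le_left hx.le hrδ
        linarith
      have h4 : 1 + y ^ 2 ≤ A * r ^ 2 := by
        have h5 : y ^ 2 ≤ (r * (1 + x / δ)) ^ 2 := by gcongr
        have h6 : 1 ≤ (r / δ) ^ 2 := one_le_pow₀ hrδ
        have h7 : A * r ^ 2 = (r / δ) ^ 2 + (r * (1 + x / δ)) ^ 2 := by
          simp only [hA]; ring
        linarith
      have h8 : A⁻¹ * (1 + y ^ 2) ≤ t ^ 2 + (y - x) ^ 2 := by
        rw [inv_mul_le_iff₀ hA0, ← sq_abs (y - x), ← hr]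
        nlinarith [sq_nonneg t]
      calc poissonKernel lam t x y * y ^ (2 * lam)
          ≤ poissonConst lam * t * (t ^ 2 + (y - x) ^ 2) ^ (-lam - 1) * y ^ (2 * lam) := by
            gcongr
            exact hm.poissonKernel_le hlam ht hx hy
        _ ≤ poissonConst lam * t * (A⁻¹ * (1 + y ^ 2)) ^ (-lam - 1) * y ^ (2 * lam) := by
            gcongr ?_ * ?_ * _
            exact Real.rpow_le_rpow_of_nonpos (by positivity) h8 (by linarith)
        _ = _ := by
            rw [Real.mul_rpow (by positivity) (by positivity), poissonFactor_eq]
            ring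

theorem exists_poissonFactor_le (hm : IsAngularMeasure lam m) (hlam : 0 ≤ lam) {t : ℝ}
    (ht : 0 < t) :
    ∃ C, ∀ y, 0 < y → poissonFactor lam y ≤ C * (poissonKernel lam t 1 y * y ^ (2 * lam)) := by
  have hc := poissonConst_pos hlam
  set A := poissonConst lam * t * (t ^ 2 + 2) ^ (-lam - 1) with hA
  have hA0 : 0 < A := by positivity
  refine ⟨A⁻¹, fun y hy => ?_⟩
  have h := hm.le_poissonKernel hlam ht one_pos hy
  have h1 : ((t ^ 2 + 2) * (1 + y ^ 2)) ^ (-lam - 1) ≤ (t ^ 2 + (1 + y) ^ 2) ^ (-lam - 1) := by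
    refine Real.rpow_le_rpow_of_nonpos (by positivity) ?_ (by linarith)
    nlinarith [sq_nonneg (1 - y), mul_nonneg (sq_nonneg t) (sq_nonneg y)]
  rw [Real.mul_rpow (by positivity) (by positivity)] at h1
  rw [poissonFactor_eq]
  calc _ = A⁻¹ * (poissonConst lam * t * ((t ^ 2 + 2) ^ (-lam - 1) * (1 + y ^ 2) ^ (-lam - 1)) *
        y ^ (2 * lam)) := by
        rw [← mul_assoc (poissonConst lam * t), ← hA]; field_simp
    _ ≤ A⁻¹ * (poissonConst lam * t * (t ^ 2 + (1 + y) ^ 2) ^ (-lam - 1) * y ^ (2 * lam)) := by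
        gcongr
    _ ≤ _ := by gcongr

end PoissonTransform

section Weight

variable {v : ℝ → ℝ} {p : ℝ≥0∞}

theorem aestronglyMeasurable_weightMeasure_iff (hv : IsWeight v) {f : ℝ → ℝ} :
    AEStronglyMeasurable f (weightMeasure v) ↔
      AEStronglyMeasurable f (volume.restrict (Ioi (0 : ℝ))) := by
  refine ⟨fun h => h.mono_ac ?_, fun h => h.mono_ac (withDensity_absolutelyContinuous _ _)⟩
  refine withDensity_absolutelyContinuous' hv.1.ennreal_ofReal ?_
  filter_upwards [ae_restrict_mem measurableSet_Ioi] with y hy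
  simpa using hv.2 y hy

theorem eLpNorm_weightMeasure (hv : IsWeight v) (hp0 : p ≠ 0) (hp : p ≠ ⊤) {f : ℝ → ℝ}
    (hf : AEStronglyMeasurable f (volume.restrict (Ioi (0 : ℝ)))) :
    eLpNorm f p (weightMeasure v) =
      eLpNorm (fun y => v y ^ (1 / p.toReal) * f y) p (volume.restrict (Ioi (0 : ℝ))) := by
  have hP : 0 < p.toReal := ENNReal.toReal_pos hp0 hp
  rw [eLpNorm_eq_lintegral_rpow_enorm_toReal hp0 hp, eLpNorm_eq_lintegral_rpow_enorm_toReal hp0 hp,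
    weightMeasure, lintegral_withDensity_eq_lintegral_mul₀ hv.1.ennreal_ofReal
      (hf.enorm.pow_const _)]
  congr 1
  refine setLIntegral_congr_fun measurableSet_Ioi fun y hy => ?_
  have hvy := hv.2 y hy
  have hv1 : 0 < v y ^ (1 / p.toReal) := Real.rpow_pos_of_pos hvy _
  simp only [Pi.mul_apply]
  rw [enorm_mul, ENNReal.mul_rpow_of_nonneg _ _ hP.le, Real.enorm_of_nonneg hv1.le,
    ENNReal.ofReal_rpow_of_nonneg hv1.le hP.le, ← Real.rpow_mul hvy.le,
    one_div_mul_cancel hP.ne', Real.rpow_one]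

theorem aestronglyMeasurable_weight_rpow (hv : IsWeight v) (a : ℝ) :
    AEStronglyMeasurable (fun y => v y ^ a) (volume.restrict (Ioi (0 : ℝ))) :=
  (hv.1.pow_const a).aestronglyMeasurable

theorem memLp_weightMeasure_iff (hv : IsWeight v) (hp0 : p ≠ 0) (hp : p ≠ ⊤) {f : ℝ → ℝ}
    (hf : AEStronglyMeasurable f (volume.restrict (Ioi (0 : ℝ)))) :
    MemLp f p (weightMeasure v) ↔
      MemLp (fun y => v y ^ (1 / p.toReal) * f y) p (volume.restrict (Ioi (0 : ℝ))) := by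
  rw [MemLp, MemLp, eLpNorm_weightMeasure hv hp0 hp hf, aestronglyMeasurable_weightMeasure_iff hv]
  exact and_congr_left fun _ =>
    ⟨fun _ => (aestronglyMeasurable_weight_rpow hv _).mul hf, fun _ => hf⟩

theorem integrableOn_mul_of_memLp (hv : IsWeight v) (hp1 : 1 ≤ p) (hp : p ≠ ⊤) {φ f : ℝ → ℝ}
    (hφ : MemLp (fun y => v y ^ (-(1 / p.toReal)) * φ y) p.conjExponent
      (volume.restrict (Ioi (0 : ℝ)))) (hf : MemLp f p (weightMeasure v)) :
    IntegrableOn (fun y => φ y * f y) (Ioi 0) := by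
  have hp0 : p ≠ 0 := (one_pos.trans_le hp1).ne'
  have := ENNReal.HolderConjugate.conjExponent hp1
  have hfm := (aestronglyMeasurable_weightMeasure_iff hv).1 hf.1
  have h := ((memLp_weightMeasure_iff hv hp0 hp hfm).1 hf).integrable_mul hφ
  refine IntegrableOn.congr_fun (s := Ioi 0) h (fun y hy => ?_) measurableSet_Ioi
  have hvy := hv.2 y hy
  simp only [Pi.mul_apply]
  rw [Real.rpow_neg hvy.le]
  have : 0 < v y ^ (1 / p.toReal) := by positivity
  field_simp

theorem memLp_of_forall_integrableOn_mul (hv : IsWeight v) (hp1 : 1 ≤ p) (hp : p ≠ ⊤)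
    {φ K : ℝ → ℝ} (hK : AEStronglyMeasurable K (volume.restrict (Ioi (0 : ℝ))))
    (hφ : AEStronglyMeasurable φ (volume.restrict (Ioi (0 : ℝ))))
    (hφ0 : ∀ y, 0 < y → 0 ≤ φ y) (hle : ∃ C, ∀ y, 0 < y → φ y ≤ C * K y)
    (h : ∀ f, MemLp f p (weightMeasure v) → IntegrableOn (fun y => K y * f y) (Ioi 0)) :
    MemLp (fun y => v y ^ (-(1 / p.toReal)) * φ y) p.conjExponent
      (volume.restrict (Ioi (0 : ℝ))) := by
  have hp0 : p ≠ 0 := (one_pos.trans_le hp1).ne'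
  have := ENNReal.HolderConjugate.conjExponent hp1
  have hw := aestronglyMeasurable_weight_rpow hv (-(1 / p.toReal))
  have h1 : MemLp (fun y => v y ^ (-(1 / p.toReal)) * K y) p.conjExponent
      (volume.restrict (Ioi (0 : ℝ))) := by
    refine memLp_of_forall_integrable_mul hp (hw.mul hK) fun g hg => ?_
    have hg' : MemLp (fun y => v y ^ (-(1 / p.toReal)) * g y) p (weightMeasure v) := by
      refine (memLp_weightMeasure_iff hv hp0 hp (hw.mul hg.1)).2 (hg.ae_eq ?_)
      filter_upwards [ae_restrict_mem measurableSet_Ioi] with y hy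
      have hvy := hv.2 y hy
      simp only [Pi.mul_apply]
      rw [← mul_assoc, ← Real.rpow_add hvy, add_neg_cancel, Real.rpow_zero, one_mul]
    refine (h _ hg').congr_fun (fun y _ => ?_) measurableSet_Ioi
    simp only; ring
  obtain ⟨C, hC⟩ := hle
  refine (h1.const_mul C).of_le (hw.mul hφ) ?_
  filter_upwards [ae_restrict_mem measurableSet_Ioi] with y hy
  have hvy := Real.rpow_pos_of_pos (hv.2 y hy) (-(1 / p.toReal))
  rw [Real.norm_of_nonneg (mul_nonneg hvy.le (hφ0 y hy))]
  refine le_trans ?_ (le_abs_self _)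
  calc _ ≤ v y ^ (-(1 / p.toReal)) * (C * K y) := by
        gcongr
        exact hC y hy
    _ = _ := by ring

end Weight

end Bessel

theorem corollary1p2 (lam : ℝ) (hlam : 0 ≤ lam) (p : ℝ≥0∞) (hp1 : 1 ≤ p) (hp : p ≠ ⊤)
    (T : EReal) (hT : 0 < T) (v : ℝ → ℝ) (hv : Bessel.IsWeight v) :
    (v ∈ Bessel.heatClass lam T p ↔
      ∀ t ∈ Bessel.timeInterval T,
        MemLp (fun y => v y ^ (-(1 / p.toReal)) * Bessel.heatFactor lam t y)
          p.conjExponent (volume.restrict (Ioi (0 : ℝ)))) ∧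
    (v ∈ Bessel.poissonClass lam T p ↔
      MemLp (fun y => v y ^ (-(1 / p.toReal)) * Bessel.poissonFactor lam y)
        p.conjExponent (volume.restrict (Ioi (0 : ℝ)))) := by
  obtain ⟨m, hm⟩ := Bessel.exists_isAngularMeasure hlam
  refine ⟨⟨?_, ?_⟩, ⟨?_, ?_⟩⟩
  · rintro ⟨-, h⟩ t ht
    refine Bessel.memLp_of_forall_integrableOn_mul hv hp1 hp
      (hm.integral_heatKernel hlam ht.1 one_pos).1.1
      ((Bessel.continuousOn_heatFactor t).aestronglyMeasurable measurableSet_Ioi)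
      (fun y hy => (Bessel.heatFactor_pos hy).le) (Bessel.exists_heatFactor_le hm hlam ht.1)
      fun f hf => ((h f hf).1 t ht 1 one_pos).congr_fun (fun y _ => ?_) measurableSet_Ioi
    simp only; ring
  · intro h
    refine ⟨hv, fun f hf => ?_⟩
    have hfm := (Bessel.aestronglyMeasurable_weightMeasure_iff hv).1 hf.1
    have hfi := fun t ht => Bessel.integrableOn_mul_of_memLp hv hp1 hp (h t ht) hf
    exact ⟨fun t ht x hx => (Bessel.heatExtension_eq hm hlam hfm hfi ht hx).1,
      Bessel.smoothOn_heatExtension hm hlam hfm hfi, Bessel.heatEq_heatExtension hm hlam hfm hfi,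
      Bessel.hasInitialData_heatExtension hm hlam hT hfm hfi⟩
  · rintro ⟨-, h⟩
    obtain ⟨t, ht⟩ := Bessel.exists_mem_timeInterval hT
    refine Bessel.memLp_of_forall_integrableOn_mul hv hp1 hp
      (hm.integral_poissonKernel hlam ht.1 one_pos).1.1
      (Bessel.continuousOn_poissonFactor.aestronglyMeasurable measurableSet_Ioi)
      (fun y hy => (Bessel.poissonFactor_pos hy).le) (Bessel.exists_poissonFactor_le hm hlam ht.1)
      fun f hf => ((h f hf).1 t ht 1 one_pos).congr_fun (fun y _ => ?_) measurableSet_Ioi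
    simp only; ring
  · intro h
    refine ⟨hv, fun f hf => ?_⟩
    have hfm := (Bessel.aestronglyMeasurable_weightMeasure_iff hv).1 hf.1
    have hfi := Bessel.integrableOn_mul_of_memLp hv hp1 hp h hf
    exact ⟨fun t ht x hx => (Bessel.poissonExtension_eq hm hlam hfm hfi ht.1 hx).1,
      Bessel.smoothOn_poissonExtension hm hlam hfm hfi,
      Bessel.poissonEq_poissonExtension hm hlam hfm hfi,
      Bessel.hasInitialData_poissonExtension hm hlam hfm hfi⟩
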